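/- Conventions. $m_N$ is Lebesgue measure on $\mathbb{R}^N$, $B^N(x,r)$ is the open Euclidean ball, $\nu_N=m_N(B^N(0,1))$, and $u^+=\max\{u,0\}$. For an open set $D\subset\mathbb{R}^N$ and $K\ge 1$, a function $u:D\to[-\infty,+\infty)$ is called $K$-quasinearly subharmonic if it is Lebesgue measurable, $u^+\in\mathcal{L}^1_{\mathrm{loc}}(D)$, and $$u_M(x)\le \frac{K}{\nu_N r^N}\int_{B^N(x,r)}u_M(y)\,dm_N(y)$$ for all $M\ge 0$ and all $x$, $r>0$ with $\overline{B^N(x,r)}\subset D$, where $u_M:=\max\{u,-M\}+M$. It is called quasinearly subharmonic if it is $K$-quasinearly subharmonic for some $K\ge 1$. "Increasing" means nondecreasing. The inverse of $f:[0,+\infty)\to[0,+\infty)$ is said to be defined on a set $T$ if every $t\in T$ equals $f(s)$ for exactly one $s\in[0,+\infty)$; then $f^{-1}(t):=s$. Theorem 4.1. Let $K\ge 1$. Let $\Omega$ be a domain in $\mathbb{R}^{m+n}=\mathbb{R}^m\times\mathbb{R}^n$, $m\ge n\ge 2$. Let $u:\Omega\to[-\infty,+\infty)$ be a Lebesgue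 measurable function. Suppose that the following conditions are satisfied: (a) For each $y\in\mathbb{R}^n$ the function $x\mapsto u(x,y)$ is $K$-quasinearly subharmonic on $\Omega(y)=\{x\in\mathbb{R}^m:(x,y)\in\Omega\}$. (b) For each $x\in\mathbb{R}^m$ the function $y\mapsto u(x,y)$ is $K$-quasinearly subharmonic on $\Omega(x)=\{y\in\mathbb{R}^n:(x,y)\in\Omega\}$. (c) There are increasing functions $\varphi:[0,+\infty)\to[0,+\infty)$ and $\psi:[0,+\infty)\to[0,+\infty)$ and $s_0,s_1\in\mathbb{N}$, $s_0<s_1$, such that (c1) the inverse functions $\varphi^{-1}$ and $\psi^{-1}$ are defined on $[\min\{\varphi(s_1-s_0),\psi(s_1-s_0)\},+\infty)$; (c2) $2K(\psi^{-1}\circ\varphi)(s-s_0)\le(\psi^{-1}\circ\varphi)(s)$ for all real $s\ge s_1$; (c3) the following integral is convergent: $$\int_{s_5}^{+\infty}\left[\frac{(\psi^{-1}\circ\varphi)(s+2)}{(\psi^{-1}\circ\varphi)(s)}\cdot\frac{1}{\varphi(s-s_0)}\right]^{\frac{1}{m-1}}\left(\int_{s_5+s_0+2}^{s+s_0+2}\left[\frac{(\psi^{-1}\circ\varphi)(t+2)}{(\psi^{-1}\circ\varphi)(t)}\right]^{\frac{1}{n-1}}dt\right)^{\frac{n-1}{m-1}}ds<+\infty,$$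 where $s_5:=\max\{s_0+s_1+3,\ s_0+(\psi^{-1}\circ\varphi)(s_1+3),\ s_0+(\varphi^{-1}\circ\psi)(s_1+3)\}$; (c4) $\psi\circ u^+\in\mathcal{L}^1_{\mathrm{loc}}(\Omega)$. Then $u$ is quasinearly subharmonic in $\Omega$. -/

import Mathlib

open MeasureTheory Set

noncomputable section

/-- The positive part `u⁺ = max u 0` of a `[-∞, +∞)`-valued function, as a real-valued function
(at a point where `u = +∞`, which the definitions below exclude, the value is the junk value `0`). -/
def realPosPart {E : Type*} (u : E → EReal) (x : E) : ℝ :=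
  (max (u x) 0).toReal

/-- `u_M = max {u, -M} + M`, as a function with values in `[0, +∞]`. -/
def truncShift {E : Type*} (u : E → EReal) (M : ℝ) (x : E) : ENNReal :=
  (max (u x) ((-M : ℝ) : EReal) + (M : EReal)).toENNReal

/-- `u` is a `K`-quasinearly subharmonic function `D → [-∞, +∞)`, for an open subset `D` of a
Euclidean space. Only the values of `u` on `D` matter. `NullMeasurable` with respect to Lebesgue
measure on `D` is Lebesgue measurability on `D`, and `volume (Metric.ball x r)` is `ν_N r ^ N`. -/
structure IsKQuasinearlySubharmonicOn {E : Type*} [NormedAddCommGroup E] [InnerProductSpace ℝ E]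
    [FiniteDimensional ℝ E] [MeasurableSpace E] [BorelSpace E]
    (K : ℝ) (u : E → EReal) (D : Set E) : Prop where
  lt_top : ∀ x ∈ D, u x < ⊤
  measurable : NullMeasurable u (volume.restrict D)
  locallyIntegrable_realPosPart : LocallyIntegrableOn (realPosPart u) D volume
  mean_value : ∀ (x : E) (r : ℝ), 0 < r → Metric.closedBall x r ⊆ D → ∀ M : ℝ, 0 ≤ M →
    truncShift u M x ≤
      ENNReal.ofReal K / volume (Metric.ball x r) * ∫⁻ y in Metric.ball x r, truncShift u M y

/-- `u` is quasinearly subharmonic on `D`: it is `K`-quasinearly subharmonic for some `K ≥ 1`. -/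
def IsQuasinearlySubharmonicOn {E : Type*} [NormedAddCommGroup E] [InnerProductSpace ℝ E]
    [FiniteDimensional ℝ E] [MeasurableSpace E] [BorelSpace E]
    (u : E → EReal) (D : Set E) : Prop :=
  ∃ K : ℝ, 1 ≤ K ∧ IsKQuasinearlySubharmonicOn K u D

/-- `f` restricts to an increasing (i.e. nondecreasing) function `[0, +∞) → [0, +∞)`. -/
def IsIncreasingHalfLine (f : ℝ → ℝ) : Prop :=
  MonotoneOn f (Ici 0) ∧ MapsTo f (Ici 0) (Ici 0)

/-- The inverse of `f : [0, +∞) → [0, +∞)` is defined on `T`: every value in `T` is taken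
exactly once. -/
def InverseDefinedOn (f : ℝ → ℝ) (T : Set ℝ) : Prop :=
  ∀ t ∈ T, ∃! s : ℝ, 0 ≤ s ∧ f s = t

/-- The inverse of `f : [0, +∞) → [0, +∞)`; meaningful at those `t` which have exactly one
preimage in `[0, +∞)`. -/
def halfLineInv (f : ℝ → ℝ) : ℝ → ℝ :=
  Function.invFunOn f (Ici 0)

/-- The composition `ψ⁻¹ ∘ φ`. -/
def invComp (ψ φ : ℝ → ℝ) (s : ℝ) : ℝ :=
  halfLineInv ψ (φ s)

/-- The number `s₅ = max {s₀ + s₁ + 3, s₀ + (ψ⁻¹ ∘ φ)(s₁ + 3), s₀ + (φ⁻¹ ∘ ψ)(s₁ + 3)}`. -/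
def sFive (φ ψ : ℝ → ℝ) (s₀ s₁ : ℕ) : ℝ :=
  max ((s₀ : ℝ) + s₁ + 3) (max (s₀ + invComp ψ φ (s₁ + 3)) (s₀ + invComp φ ψ (s₁ + 3)))

/-- The integrand, as a function of the outer variable `s`, of the double integral in the growth
condition. -/
def growthIntegrand (m n : ℕ) (φ ψ : ℝ → ℝ) (s₀ s₁ : ℕ) (s : ℝ) : ℝ :=
  (invComp ψ φ (s + 2) / invComp ψ φ s * (1 / φ (s - s₀))) ^ (1 / ((m : ℝ) - 1)) *
    (∫ t in (sFive φ ψ s₀ s₁ + s₀ + 2)..(s + s₀ + 2),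
      (invComp ψ φ (t + 2) / invComp ψ φ t) ^ (1 / ((n : ℝ) - 1))) ^
        (((n : ℝ) - 1) / ((m : ℝ) - 1))

end

/-!
The mean value inequality for `u` in the product space follows from the two separate ones by
Tonelli's theorem (`truncShift_le_of_separate`), with the constant `K² 2^(m+n)`. What remains is the
local integrability of `u⁺`, and `u⁺` is even locally bounded (`exists_bound_polydisc`).

The bound rests on Domar's method. Put `g = ψ⁻¹ ∘ φ`. If a function `w ≥ 0` with the mean value
inequality is at least `g j` at a point, then it reaches `g (j + 1)` within a distance controlled by
the measure of the set where `g (j - s₀) ≤ w < g (j + 1)`, since `2 K g (j - s₀) ≤ g j`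
(`exists_le_of_measure_lt`). A locally bounded `w` cannot climb forever, so along such a chain the
distances sum to at least the radius of the ball (`ofReal_radius_le_tsum`). Hölder's inequality turns
this into a lower bound for the integral of any density that is large where `w` is large
(`ofReal_radius_rpow_le`).

This is used twice (`exists_bound_of_separate_mean_value`). For fixed `y`, a large value of `u (·, y)`
forces the mass `W y = ∫ ψ (u⁺ (x, y)) dx` to be large. For fixed `x`, a large value of `u (x, ·)`,
now with the density `W`, forces the integral of `W` to be large; it is finite because `ψ ∘ u⁺` is
locally integrable. With `τ i = (g (i + 1) / g i / φ (i - s₀)) ^ (1 / (m - 1))`,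
`ω k = (g (k + s₀ + 1) / g (k + s₀)) ^ (1 / (n - 1))` and `q = (m - 1) / (n - 1) ≥ 1`, the two chains
give a lower bound for `∑ k ≥ N, ω k (∑ i ≥ k, τ i) ^ q`. By Minkowski's inequality
(`ENNReal.tsum_mul_tail_rpow_le`) the `q`-th root of this series is at most
`∑ i ≥ N, τ i (∑ N ≤ k ≤ i, ω k) ^ (1 / q)`, which is dominated by a tail of the growth integral
(`tsum_le_lintegral_growthIntegrand`) and so tends to `0` as `N` grows. A large value of `u⁺` is
therefore impossible.
-/

open Filter Topology Metric

/-! ### Domar's chains -/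

/-- Domar's step. If `w` satisfies the mean value inequality on a ball, is at least `l` at the
centre, and the set of points of the ball where `w` lies between the levels `h` and `t` is small
compared with the ball, then `w` reaches the level `t` in the ball: otherwise the low values
contribute at most `K h ≤ l / 2` to the mean, and the remaining ones less than `l / 2`. -/
theorem exists_le_of_measure_lt {E : Type*} [NormedAddCommGroup E] [InnerProductSpace ℝ E]
    [FiniteDimensional ℝ E] [MeasurableSpace E] [BorelSpace E] {K : ENNReal}
    {w : E → ENNReal} {x : E} {r : ℝ} (hr : 0 < r)
    (hw : w x ≤ K / volume (ball x r) * ∫⁻ y in ball x r, w y)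
    {h l t : ENNReal} (hl0 : l ≠ 0) (hl : l ≠ ⊤) (hhl : 2 * K * h ≤ l) (hx : l ≤ w x)
    (hA : 2 * K * (t / l) * volume {y ∈ ball x r | h ≤ w y ∧ w y < t} < volume (ball x r)) :
    ∃ y ∈ ball x r, t ≤ w y := by
  by_contra! hlt
  set V := volume (ball x r)
  have hV0 : V ≠ 0 := (measure_ball_pos volume x hr).ne'
  have hVt : V ≠ ⊤ := measure_ball_lt_top.ne
  set A := {y ∈ ball x r | h ≤ w y ∧ w y < t}
  have h1 : ∫⁻ y in ball x r, w y ≤ h * V + t * volume A := by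
    calc ∫⁻ y in ball x r, w y ≤ ∫⁻ y in ball x r, (h + A.indicator (fun _ => t) y) := by
          refine setLIntegral_mono' measurableSet_ball fun y hy => ?_
          by_cases hyA : y ∈ A
          · rw [indicator_of_mem hyA]
            exact hyA.2.2.le.trans le_add_self
          · rw [indicator_of_notMem hyA, add_zero]
            by_contra! hh
            exact hyA ⟨hy, hh.le, hlt y hy⟩
      _ ≤ h * V + t * volume A := by
          rw [lintegral_add_left measurable_const, setLIntegral_const]
          gcongr
          calc ∫⁻ y in ball x r, A.indicator (fun _ => t) y ≤ ∫⁻ y, A.indicator (fun _ => t) y :=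
                setLIntegral_le_lintegral _ _
            _ ≤ _ := lintegral_indicator_const_le _ _
  have h2 : 2 * l ≤ l + 2 * K * t * volume A / V := by
    calc 2 * l ≤ 2 * (K / V * (h * V + t * volume A)) := by
          gcongr; exact hx.trans (hw.trans (by gcongr))
      _ = 2 * K * h * (V / V) + 2 * K * t * volume A / V := by
          simp only [div_eq_mul_inv]; ring
      _ ≤ _ := by rw [ENNReal.div_self hV0 hVt, mul_one]; gcongr
  have h3 : l ≤ 2 * K * t * volume A / V := by
    rw [two_mul] at h2
    exact (ENNReal.add_le_add_iff_left hl).1 h2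
  have h4 : V ≤ 2 * K * (t / l) * volume A := by
    have := (ENNReal.le_div_iff_mul_le (Or.inl hV0) (Or.inl hVt)).1 h3
    have h5 : V ≤ 2 * K * t * volume A / l := by
      rw [ENNReal.le_div_iff_mul_le (Or.inl hl0) (Or.inl hl), mul_comm]; exact this
    refine h5.trans (le_of_eq ?_)
    simp only [div_eq_mul_inv]; ring
  exact absurd hA (not_lt.2 h4)

/-- Domar's chain. A bounded `w` with the mean value inequality cannot climb through all the
levels `g p, g (p + 1), …` inside `ball x₀ ρ`. As every step is possible within a radius governed by
the measure of a level set, these radii have to add up to at least `ρ`. -/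
theorem ofReal_radius_le_tsum {E : Type*} [NormedAddCommGroup E] [InnerProductSpace ℝ E]
    [FiniteDimensional ℝ E] [MeasurableSpace E] [BorelSpace E] (hd : 0 < Module.finrank ℝ E)
    {K : ENNReal} {w : E → ENNReal} {x₀ : E} {ρ : ℝ}
    (hmean : ∀ x r, 0 < r → closedBall x r ⊆ ball x₀ ρ →
      w x ≤ K / volume (ball x r) * ∫⁻ y in ball x r, w y)
    {C : ENNReal} (hC : C ≠ ⊤) (hbdd : ∀ x ∈ ball x₀ ρ, w x ≤ C)
    {g : ℕ → ENNReal} {p : ℕ} (hg0 : ∀ k, g k ≠ 0) (hgt : ∀ k, g k ≠ ⊤)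
    (hstep : ∀ k, 2 * K * g k ≤ g (k + p)) (hlim : Tendsto g atTop (𝓝 ⊤)) (hx₀ : g p ≤ w x₀) :
    ENNReal.ofReal ρ ≤ ∑' k, (2 * K * (g (k + p + 1) / g (k + p)) *
      volume {y ∈ ball x₀ ρ | g k ≤ w y ∧ w y < g (k + p + 1)} / volume (ball (0 : E) 1)) ^
        (1 / (Module.finrank ℝ E : ℝ)) := by
  by_contra! hlt
  set d := Module.finrank ℝ E
  have hd' : (0 : ℝ) < d := by exact_mod_cast hd
  set ν := volume (ball (0 : E) 1)
  have hν0 : ν ≠ 0 := (measure_ball_pos volume (0 : E) one_pos).ne'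
  have hνt : ν ≠ ⊤ := measure_ball_lt_top.ne
  set A : ℕ → Set E := fun k => {y ∈ ball x₀ ρ | g k ≤ w y ∧ w y < g (k + p + 1)}
  set e : ℕ → ENNReal := fun k =>
    (2 * K * (g (k + p + 1) / g (k + p)) * volume (A k) / ν) ^ (1 / (d : ℝ))
  change ∑' k, e k < _ at hlt
  -- A step needs a strict inequality of measures, so the radii are enlarged by summable `ε k`.
  obtain ⟨ε, hε, hεsum⟩ := ENNReal.exists_pos_sum_of_countable (tsub_pos_of_lt hlt).ne' ℕ
  have hsum : ∑' k, (e k + ε k) < ENNReal.ofReal ρ := by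
    rw [ENNReal.tsum_add, add_comm]
    exact lt_tsub_iff_right.1 hεsum
  have het : ∀ k, e k + ε k ≠ ⊤ := fun k => ne_top_of_lt ((ENNReal.le_tsum k).trans_lt hsum)
  set r : ℕ → ℝ := fun k => (e k + ε k).toReal
  have hr : ∀ k, 0 < r k := fun k =>
    ENNReal.toReal_pos (by simpa using fun _ => (hε k).ne') (het k)
  have hrsum : ∀ k, ∑ i ∈ Finset.range k, r i < ρ := by
    intro k
    rw [← ENNReal.toReal_sum (fun i _ => het i)]
    exact (ENNReal.lt_ofReal_iff_toReal_lt (by simp [ENNReal.sum_eq_top, het])).1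
      ((ENNReal.sum_le_tsum _).trans_lt hsum)
  have hvol : ∀ k (x : E),
      2 * K * (g (k + p + 1) / g (k + p)) * volume (A k) < volume (ball x (r k)) := by
    intro k x
    rw [Measure.addHaar_ball_of_pos _ _ (hr k), ENNReal.ofReal_pow (hr k).le,
      ENNReal.ofReal_toReal (het k)]
    have h1 : e k < e k + ε k :=
      ENNReal.lt_add_right (ne_top_of_le_ne_top (het k) le_self_add) (by simpa using (hε k).ne')
    rw [← ENNReal.div_lt_iff (Or.inl hν0) (Or.inl hνt)]
    have h2 : e k ^ d = 2 * K * (g (k + p + 1) / g (k + p)) * volume (A k) / ν := by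
      simp only [e]
      rw [← ENNReal.rpow_natCast, ← ENNReal.rpow_mul, one_div_mul_cancel hd'.ne', ENNReal.rpow_one]
    rw [← h2]
    exact ENNReal.pow_lt_pow_left hd.ne' h1
  -- The `k`-th point of the chain lies within the sum of the first `k` radii of `x₀`.
  have hchain : ∀ k, ∃ x, dist x x₀ ≤ ∑ i ∈ Finset.range k, r i ∧ g (k + p) ≤ w x := by
    intro k
    induction k with
    | zero => exact ⟨x₀, by simp, by simpa using hx₀⟩
    | succ k ih =>
      obtain ⟨x, hxd, hxw⟩ := ih
      have hsub : closedBall x (r k) ⊆ ball x₀ ρ := by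
        intro y hy
        have := hrsum (k + 1)
        rw [Finset.sum_range_succ] at this
        have h3 := dist_triangle y x x₀
        rw [mem_closedBall] at hy
        rw [mem_ball]; linarith
      obtain ⟨y, hy, hyw⟩ := exists_le_of_measure_lt (t := g (k + p + 1)) (hr k)
        (hmean x (r k) (hr k) hsub) (hg0 _) (hgt _) (hstep k) hxw
        ((by gcongr; exact fun y hy => ⟨hsub (ball_subset_closedBall hy.1), hy.2⟩ :
          _ ≤ 2 * K * (g (k + p + 1) / g (k + p)) * volume (A k)).trans_lt (hvol k x))
      refine ⟨y, ?_, by rwa [add_right_comm]⟩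
      rw [Finset.sum_range_succ]
      have h3 := dist_triangle y x x₀
      rw [mem_ball] at hy
      linarith
  have hall : ∀ k, g (k + p) ≤ C := fun k => by
    obtain ⟨x, hxd, hxw⟩ := hchain k
    exact hxw.trans (hbdd x (hxd.trans_lt (hrsum k)))
  have := le_of_tendsto' ((tendsto_add_atTop_iff_nat p).2 hlim) hall
  exact hC (top_le_iff.1 this)

/-! ### The chain bound with a density -/

/-- Hölder's inequality for series in `[0, ∞]`. -/
theorem ENNReal.tsum_mul_le_rpow_mul_rpow {ι : Type*} {p q : ℝ} (hpq : p.HolderConjugate q)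
    (f g : ι → ENNReal) :
    ∑' i, f i * g i ≤ (∑' i, f i ^ p) ^ (1 / p) * (∑' i, g i ^ q) ^ (1 / q) := by
  refine ENNReal.summable.tsum_le_of_sum_le fun s => ?_
  refine (ENNReal.inner_le_Lp_mul_Lq s f g hpq).trans ?_
  have := hpq.pos
  have := hpq.symm.pos
  gcongr <;> exact ENNReal.sum_le_tsum s

/-- Each point belongs to at most `p + 1` of the level sets, so that the measures of the level sets,
weighted by lower bounds `c k` of `P`, sum to at most `p + 1` times the integral of `P`. -/
theorem tsum_measure_level_le_lintegral {E : Type*} [MeasurableSpace E] {μ : Measure E}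
    {w P : E → ENNReal} (hw : AEMeasurable w μ) {g c : ℕ → ENNReal} (hg : Monotone g) (p : ℕ)
    {S : Set E} (hS : NullMeasurableSet S μ) (hP : ∀ k, ∀ y ∈ S, g k ≤ w y → c k ≤ P y) :
    ∑' k, c k * μ {y ∈ S | g k ≤ w y ∧ w y < g (k + p + 1)} ≤ (p + 1) * ∫⁻ y in S, P y ∂μ := by
  set A : ℕ → Set E := fun k => {y ∈ S | g k ≤ w y ∧ w y < g (k + p + 1)}
  have hA : ∀ k, NullMeasurableSet (A k) μ := fun k =>
    hS.inter ((hw.nullMeasurable measurableSet_Ici).inter (hw.nullMeasurable measurableSet_Iio))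
  calc ∑' k, c k * μ (A k) = ∑' k, ∫⁻ y, (A k).indicator (fun _ => c k) y ∂μ := by
        congr 1; ext k; rw [lintegral_indicator_const₀ (hA k)]
    _ = ∫⁻ y, ∑' k, (A k).indicator (fun _ => c k) y ∂μ :=
        (lintegral_tsum fun k => aemeasurable_const.indicator₀ (hA k)).symm
    _ ≤ ∫⁻ y, S.indicator (fun y => (p + 1) * P y) y ∂μ := by
        refine lintegral_mono fun y => ?_
        by_cases hy : y ∈ S
        · rw [indicator_of_mem hy]
          by_cases hex : ∃ k, w y < g (k + p + 1)
          · classical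
            -- By monotonicity, only the indices from `k₀` to `k₀ + p` can occur.
            set k₀ := Nat.find hex
            have hk₀ : w y < g (k₀ + p + 1) := Nat.find_spec hex
            have hmem : ∀ k, y ∈ A k → k ∈ Finset.Icc k₀ (k₀ + p) := by
              intro k hk
              refine Finset.mem_Icc.2 ⟨Nat.find_min' hex hk.2.2, ?_⟩
              by_contra! hlt
              exact absurd (hk.2.1.trans_lt hk₀) (not_lt.2 (hg (by omega)))
            rw [tsum_eq_sum (s := Finset.Icc k₀ (k₀ + p))
              fun k hk => indicator_of_notMem (fun h => hk (hmem k h)) _]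
            calc ∑ k ∈ Finset.Icc k₀ (k₀ + p), (A k).indicator (fun _ => c k) y
                ≤ ∑ k ∈ Finset.Icc k₀ (k₀ + p), P y := by
                  refine Finset.sum_le_sum fun k _ => indicator_apply_le' (fun h => ?_)
                    fun _ => zero_le
                  exact hP k y hy h.2.1
              _ = (p + 1) * P y := by
                  rw [Finset.sum_const, Nat.card_Icc, nsmul_eq_mul]
                  congr 1
                  rw [show k₀ + p + 1 - k₀ = p + 1 by omega]; push_cast; rfl
          · push Not at hex
            rw [ENNReal.tsum_eq_zero.2 fun k =>
              indicator_of_notMem (fun h => absurd h.2.2 (not_lt.2 (hex k))) _]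
            exact zero_le
        · rw [indicator_of_notMem hy, ENNReal.tsum_eq_zero.2 fun k =>
            indicator_of_notMem (fun h => hy h.1) _]
    _ = (p + 1) * ∫⁻ y in S, P y ∂μ := by
        rw [lintegral_indicator₀ hS, lintegral_const_mul' _ _ (by simp)]

/-- The chain bound `ofReal_radius_le_tsum` combined with Hölder's inequality, for an arbitrary
density `P` that is at least `c k` wherever `w` is at least `g k`: the integral of `P` over the ball
is bounded below. It is applied in both groups of variables, with different densities. -/
theorem ofReal_radius_rpow_le {E : Type*} [NormedAddCommGroup E] [InnerProductSpace ℝ E]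
    [FiniteDimensional ℝ E] [MeasurableSpace E] [BorelSpace E] {d : ℕ}
    (hdim : Module.finrank ℝ E = d) (hd : 2 ≤ d)
    {K : ENNReal} {w : E → ENNReal} {x₀ : E} {ρ : ℝ}
    (hw : AEMeasurable w (volume.restrict (ball x₀ ρ)))
    (hmean : ∀ x r, 0 < r → closedBall x r ⊆ ball x₀ ρ →
      w x ≤ K / volume (ball x r) * ∫⁻ y in ball x r, w y)
    {C : ENNReal} (hC : C ≠ ⊤) (hbdd : ∀ x ∈ ball x₀ ρ, w x ≤ C)
    {g : ℕ → ENNReal} {p : ℕ} (hg : Monotone g) (hg0 : ∀ k, g k ≠ 0) (hgt : ∀ k, g k ≠ ⊤)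
    (hstep : ∀ k, 2 * K * g k ≤ g (k + p)) (hlim : Tendsto g atTop (𝓝 ⊤)) (hx₀ : g p ≤ w x₀)
    {P : E → ENNReal} {c : ℕ → ENNReal} (hc0 : ∀ k, c k ≠ 0) (hct : ∀ k, c k ≠ ⊤)
    (hP : ∀ k, ∀ y ∈ ball x₀ ρ, g k ≤ w y → c k ≤ P y) :
    ENNReal.ofReal ρ ^ (d : ℝ) ≤
      2 * K / volume (ball (0 : E) 1) * ((p + 1) * ∫⁻ y in ball x₀ ρ, P y) *
        (∑' k, (g (k + p + 1) / g (k + p) / c k) ^ (1 / ((d : ℝ) - 1))) ^ ((d : ℝ) - 1) := by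
  have hd2 : (2 : ℝ) ≤ d := by exact_mod_cast hd
  have hd0 : (0 : ℝ) < d := by linarith
  have hd1 : (0 : ℝ) < d - 1 := by linarith
  have key := ofReal_radius_le_tsum (by omega) hmean hC hbdd hg0 hgt hstep hlim hx₀
  rw [hdim] at key
  have hS := tsum_measure_level_le_lintegral (P := P) hw hg p (S := ball x₀ ρ)
    measurableSet_ball.nullMeasurableSet hP
  rw [Measure.restrict_restrict measurableSet_ball, inter_self] at hS
  set A : ℕ → Set E := fun k => {y ∈ ball x₀ ρ | g k ≤ w y ∧ w y < g (k + p + 1)}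
  set ν := volume (ball (0 : E) 1)
  have hS' : ∑' k, c k * volume (A k) ≤ (p + 1) * ∫⁻ y in ball x₀ ρ, P y := by
    refine le_trans (le_of_eq ?_) hS
    congr 1; ext k
    rw [Measure.restrict_eq_self _ (fun y hy => hy.1)]
  have hpq : (d : ℝ).HolderConjugate (d / (d - 1)) := Real.HolderConjugate.conjExponent (by linarith)
  have h1 : ∀ k, (2 * K * (g (k + p + 1) / g (k + p)) * volume (A k) / ν) ^ (1 / (d : ℝ)) =
      (2 * K / ν * (c k * volume (A k))) ^ (1 / (d : ℝ)) *
        (g (k + p + 1) / g (k + p) / c k) ^ (1 / (d : ℝ)) := by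
    intro k
    rw [← ENNReal.mul_rpow_of_nonneg _ _ (by positivity)]
    congr 1
    calc 2 * K * (g (k + p + 1) / g (k + p)) * volume (A k) / ν
        = 2 * K / ν * volume (A k) * (g (k + p + 1) / g (k + p)) * (c k * (c k)⁻¹) := by
          rw [ENNReal.mul_inv_cancel (hc0 k) (hct k)]; simp only [div_eq_mul_inv]; ring
      _ = _ := by simp only [div_eq_mul_inv]; ring
  have h2 : ENNReal.ofReal ρ ≤
      (2 * K / ν * ((p + 1) * ∫⁻ y in ball x₀ ρ, P y)) ^ (1 / (d : ℝ)) *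
      (∑' k, (g (k + p + 1) / g (k + p) / c k) ^ (1 / ((d : ℝ) - 1))) ^ (((d : ℝ) - 1) / d) := by
    refine key.trans ?_
    calc _ = ∑' k, (2 * K / ν * (c k * volume (A k))) ^ (1 / (d : ℝ)) *
        (g (k + p + 1) / g (k + p) / c k) ^ (1 / (d : ℝ)) := tsum_congr h1
      _ ≤ _ := ENNReal.tsum_mul_le_rpow_mul_rpow hpq _ _
      _ ≤ _ := by
        simp_rw [← ENNReal.rpow_mul]
        rw [one_div_mul_cancel hd0.ne', show 1 / (d : ℝ) * (d / (d - 1)) = 1 / (d - 1) by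
          field_simp, one_div_div]
        simp_rw [ENNReal.rpow_one]
        rw [ENNReal.tsum_mul_left]
        gcongr
  calc ENNReal.ofReal ρ ^ (d : ℝ) ≤ _ := ENNReal.rpow_le_rpow h2 hd0.le
    _ = _ := by
      rw [ENNReal.mul_rpow_of_nonneg _ _ hd0.le, ← ENNReal.rpow_mul, ← ENNReal.rpow_mul,
        one_div_mul_cancel hd0.ne', div_mul_cancel₀ _ hd0.ne', ENNReal.rpow_one]

/-! ### Minkowski's inequality for tails of series -/

/-- Minkowski's inequality for double series in `[0, ∞]`. -/
theorem ENNReal.tsum_rpow_tsum_le {q : ℝ} (hq : 1 ≤ q) (F : ℕ → ℕ → ENNReal) :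
    (∑' k, (∑' i, F i k) ^ q) ^ (1 / q) ≤ ∑' i, (∑' k, F i k ^ q) ^ (1 / q) := by
  have hq0 : 0 < q := by linarith
  have hfin : ∀ (s t : Finset ℕ), (∑ k ∈ s, (∑ i ∈ t, F i k) ^ q) ^ (1 / q) ≤
      ∑' i, (∑' k, F i k ^ q) ^ (1 / q) := by
    intro s t
    refine le_trans ?_ (ENNReal.sum_le_tsum t)
    induction t using Finset.induction_on with
    | empty => simp [hq0]
    | insert a t ha ih =>
      simp_rw [Finset.sum_insert ha]
      refine (ENNReal.Lp_add_le s _ _ hq).trans ?_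
      gcongr
      exact ENNReal.sum_le_tsum s
  have hs : ∀ s : Finset ℕ, (∑ k ∈ s, (∑' i, F i k) ^ q) ^ (1 / q) ≤
      ∑' i, (∑' k, F i k ^ q) ^ (1 / q) := by
    intro s
    have hlim : Tendsto (fun t : Finset ℕ => (∑ k ∈ s, (∑ i ∈ t, F i k) ^ q) ^ (1 / q)) atTop
        (𝓝 ((∑ k ∈ s, (∑' i, F i k) ^ q) ^ (1 / q))) := by
      refine (ENNReal.continuous_rpow_const.tendsto _).comp (tendsto_finsetSum _ fun k _ => ?_)
      exact (ENNReal.continuous_rpow_const.tendsto _).comp ENNReal.summable.hasSum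
    exact le_of_tendsto' hlim (hfin s)
  have hlim : Tendsto (fun s : Finset ℕ => (∑ k ∈ s, (∑' i, F i k) ^ q) ^ (1 / q)) atTop
      (𝓝 ((∑' k, (∑' i, F i k) ^ q) ^ (1 / q))) :=
    (ENNReal.continuous_rpow_const.tendsto _).comp ENNReal.summable.hasSum
  exact le_of_tendsto' hlim hs

/-- Minkowski's inequality for the tails of a series: the weighted `ℓ^q` norm of the tails is at
most the sum of the terms, each with the `ℓ^q` norm of the indicator of `{k | k ≤ i}`. -/
theorem ENNReal.tsum_mul_tail_rpow_le {q : ℝ} (hq : 1 ≤ q) (τ ω : ℕ → ENNReal) :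
    (∑' k, ω k * (∑' i, τ (k + i)) ^ q) ^ (1 / q) ≤
      ∑' i, τ i * (∑ k ∈ Finset.range (i + 1), ω k) ^ (1 / q) := by
  have hq0 : 0 < q := by linarith
  have hω : ∀ k, (ω k ^ (1 / q)) ^ q = ω k := fun k => by
    rw [← ENNReal.rpow_mul, one_div_mul_cancel hq0.ne', ENNReal.rpow_one]
  have htail : ∀ k, ∑' i, τ (k + i) = ∑' i, if k ≤ i then τ i else 0 := by
    intro k
    rw [← Summable.sum_add_tsum_nat_add' (f := fun i => if k ≤ i then τ i else 0) (k := k)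
      ENNReal.summable, Finset.sum_eq_zero, zero_add]
    · exact tsum_congr fun i => by simp [add_comm]
    · intro i hi
      rw [Finset.mem_range] at hi
      simp [hi]
  calc (∑' k, ω k * (∑' i, τ (k + i)) ^ q) ^ (1 / q)
      = (∑' k, (∑' i, (if k ≤ i then τ i * ω k ^ (1 / q) else 0)) ^ q) ^ (1 / q) := by
        congr 1
        refine tsum_congr fun k => ?_
        conv_lhs => rw [← hω k, htail, ← ENNReal.mul_rpow_of_nonneg _ _ hq0.le,
          ← ENNReal.tsum_mul_left]
        congr 2; ext i
        split_ifs <;> simp [mul_comm]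
    _ ≤ _ := ENNReal.tsum_rpow_tsum_le hq _
    _ = _ := by
        refine tsum_congr fun i => ?_
        rw [tsum_eq_sum (s := Finset.range (i + 1))]
        · rw [Finset.sum_congr rfl (g := fun k => τ i ^ q * ω k)]
          · rw [← Finset.mul_sum, ENNReal.mul_rpow_of_nonneg _ _ (by positivity),
              ← ENNReal.rpow_mul, mul_one_div_cancel hq0.ne', ENNReal.rpow_one]
          · intro k hk
            rw [if_pos (by simpa [Nat.lt_succ_iff] using hk),
              ENNReal.mul_rpow_of_nonneg _ _ hq0.le, hω]
        · intro k hk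
          rw [if_neg (by simpa [Nat.lt_succ_iff] using hk), ENNReal.zero_rpow_of_pos hq0]

/-! ### The inverse functions and the composition `ψ⁻¹ ∘ φ` -/

section InvComp

variable {φ ψ : ℝ → ℝ} {α : ℝ}

theorem IsIncreasingHalfLine.mem_Ici_min (hφ : IsIncreasingHalfLine φ) (hα : 0 ≤ α) {s : ℝ}
    (hs : α ≤ s) : φ s ∈ Ici (min (φ α) (ψ α)) :=
  (min_le_left _ _).trans (hφ.1 hα (hα.trans hs) hs)

theorem invComp_spec (hφ : IsIncreasingHalfLine φ) (hα : 0 ≤ α)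
    (hcψ : InverseDefinedOn ψ (Ici (min (φ α) (ψ α)))) {s : ℝ} (hs : α ≤ s) :
    0 ≤ invComp ψ φ s ∧ ψ (invComp ψ φ s) = φ s := by
  obtain ⟨y, ⟨hy0, hy⟩, -⟩ := hcψ _ (hφ.mem_Ici_min hα hs)
  have hex : ∃ a ∈ Ici (0 : ℝ), ψ a = φ s := ⟨y, hy0, hy⟩
  exact ⟨Function.invFunOn_mem hex, Function.invFunOn_eq hex⟩

theorem strictMonoOn_of_inverseDefinedOn (hφ : IsIncreasingHalfLine φ) (hα : 0 ≤ α)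
    (hcφ : InverseDefinedOn φ (Ici (min (φ α) (ψ α)))) : StrictMonoOn φ (Ici α) := by
  intro s hs t ht hst
  have hs0 : 0 ≤ s := hα.trans hs
  have ht0 : 0 ≤ t := hα.trans ht
  refine lt_of_le_of_ne (hφ.1 hs0 ht0 hst.le) fun h => ?_
  exact hst.ne ((hcφ _ (hφ.mem_Ici_min hα hs)).unique ⟨hs0, rfl⟩ ⟨ht0, h.symm⟩)

theorem strictMonoOn_invComp (hφ : IsIncreasingHalfLine φ) (hψ : IsIncreasingHalfLine ψ)
    (hα : 0 ≤ α) (hcφ : InverseDefinedOn φ (Ici (min (φ α) (ψ α))))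
    (hcψ : InverseDefinedOn ψ (Ici (min (φ α) (ψ α)))) : StrictMonoOn (invComp ψ φ) (Ici α) := by
  intro s hs t ht hst
  by_contra! hle
  have h1 := invComp_spec hφ hα hcψ hs
  have h2 := invComp_spec hφ hα hcψ ht
  have h3 := hψ.1 h2.1 h1.1 hle
  rw [h1.2, h2.2] at h3
  exact absurd (strictMonoOn_of_inverseDefinedOn hφ hα hcφ hs ht hst) (not_lt.2 h3)

theorem invComp_pos (hφ : IsIncreasingHalfLine φ) (hψ : IsIncreasingHalfLine ψ)
    (hα : 0 ≤ α) (hcφ : InverseDefinedOn φ (Ici (min (φ α) (ψ α))))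
    (hcψ : InverseDefinedOn ψ (Ici (min (φ α) (ψ α)))) {s : ℝ} (hs : α < s) :
    0 < invComp ψ φ s :=
  (invComp_spec hφ hα hcψ le_rfl).1.trans_lt
    (strictMonoOn_invComp hφ hψ hα hcφ hcψ self_mem_Ici hs.le hs)

theorem pos_of_inverseDefinedOn (hφ : IsIncreasingHalfLine φ) (hα : 0 ≤ α)
    (hcφ : InverseDefinedOn φ (Ici (min (φ α) (ψ α)))) {s : ℝ} (hs : α < s) : 0 < φ s :=
  (hφ.2 hα : (0 : ℝ) ≤ φ α).trans_lt
    (strictMonoOn_of_inverseDefinedOn hφ hα hcφ self_mem_Ici hs.le hs)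

/-- `ψ⁻¹ ∘ φ` tends to infinity: `φ` does, because it attains all large values, while `ψ` is bounded
on bounded sets. -/
theorem tendsto_invComp_atTop (hφ : IsIncreasingHalfLine φ) (hψ : IsIncreasingHalfLine ψ)
    (hα : 0 ≤ α) (hcφ : InverseDefinedOn φ (Ici (min (φ α) (ψ α))))
    (hcψ : InverseDefinedOn ψ (Ici (min (φ α) (ψ α)))) :
    Tendsto (invComp ψ φ) atTop atTop := by
  refine tendsto_atTop.2 fun M => ?_
  obtain ⟨s, ⟨hs0, hs⟩, -⟩ := hcφ (max (ψ (max M 0) + 1) (min (φ α) (ψ α)))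
    (mem_Ici.2 (le_max_right _ _))
  filter_upwards [eventually_ge_atTop s, eventually_ge_atTop α] with t hst hαt
  by_contra! hlt
  have h1 := invComp_spec hφ hα hcψ hαt
  have h2 := hψ.1 h1.1 (le_max_right M 0) (hlt.le.trans (le_max_left _ _))
  rw [h1.2] at h2
  have h3 := hφ.1 hs0 (hs0.trans hst) hst
  have h4 := le_max_left (ψ (max M 0) + 1) (min (φ α) (ψ α))
  rw [← hs] at h4
  linarith

end InvComp

theorem MonotoneOn.intervalIntegrable_div_rpow {g : ℝ → ℝ} {α e : ℝ} (hg : MonotoneOn g (Ici α))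
    (hpos : ∀ s, α ≤ s → 0 < g s) (he : 0 ≤ e) {a b : ℝ} (ha : α ≤ a) (hab : a ≤ b) :
    IntervalIntegrable (fun t => (g (t + 2) / g t) ^ e) volume a b := by
  rw [intervalIntegrable_iff_integrableOn_Icc_of_le hab]
  refine Integrable.of_bound (C := (g (b + 2) / g a) ^ e) ?_ ?_
  · have h1 : AEMeasurable (fun t => g (t + 2)) (volume.restrict (Icc a b)) :=
      aemeasurable_restrict_of_monotoneOn measurableSet_Icc fun s hs t ht hst =>
        hg (by simp only [mem_Icc, mem_Ici] at *; linarith)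
          (by simp only [mem_Icc, mem_Ici] at *; linarith) (by linarith)
    have h2 : AEMeasurable g (volume.restrict (Icc a b)) :=
      aemeasurable_restrict_of_monotoneOn measurableSet_Icc
        (hg.mono fun s hs => ha.trans hs.1)
    have h3 : AEMeasurable (fun t => g (t + 2) / g t) (volume.restrict (Icc a b)) := h1.div h2
    exact (h3.pow_const e).aestronglyMeasurable
  · filter_upwards [ae_restrict_mem measurableSet_Icc] with t ht
    have h0 := hpos t (ha.trans ht.1)
    have h1 := hpos (t + 2) (by linarith [ht.1])
    rw [Real.norm_of_nonneg (by positivity)]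
    have h2 : g (t + 2) ≤ g (b + 2) :=
      hg (by simp only [mem_Ici]; linarith [ht.1]) (by simp only [mem_Ici]; linarith)
        (by linarith [ht.2])
    have h3 : g a ≤ g t := hg ha (ha.trans ht.1) ht.1
    have h4 := hpos a ha
    have h5 := h1.trans_le h2
    gcongr

/-- Comparison of a sum with an integral, unit step by unit step: on `[c + i, c + i + 1]` the ratio
`g (t + 2) / g t` is at least `g (c + i + 2) / g (c + i + 1)`. -/
theorem sum_div_rpow_le_integral {g : ℝ → ℝ} {α e : ℝ} (hg : MonotoneOn g (Ici α))
    (hpos : ∀ s, α ≤ s → 0 < g s) (he : 0 ≤ e) {a b c : ℝ} (hac : α ≤ a) {k : ℕ} (ha : a ≤ c)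
    (hb : c + k ≤ b) :
    ∑ i ∈ Finset.range k, (g (c + i + 2) / g (c + i + 1)) ^ e ≤
      ∫ t in a..b, (g (t + 2) / g t) ^ e := by
  have hI : ∀ {x y : ℝ}, a ≤ x → x ≤ y →
      IntervalIntegrable (fun t => (g (t + 2) / g t) ^ e) volume x y := fun hx hxy =>
    hg.intervalIntegrable_div_rpow hpos he (hac.trans hx) hxy
  have hk : (0 : ℝ) ≤ k := k.cast_nonneg
  calc ∑ i ∈ Finset.range k, (g (c + i + 2) / g (c + i + 1)) ^ e
      ≤ ∑ i ∈ Finset.range k, ∫ t in (c + (i : ℕ))..(c + (i + 1 : ℕ)), (g (t + 2) / g t) ^ e := by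
        refine Finset.sum_le_sum fun i _ => ?_
        have hi : (0 : ℝ) ≤ i := i.cast_nonneg
        have := intervalIntegral.integral_mono_on (a := c + i) (b := c + (i + 1 : ℕ))
          (f := fun _ => (g (c + i + 2) / g (c + i + 1)) ^ e)
          (g := fun t => (g (t + 2) / g t) ^ e) (by push_cast; linarith)
          intervalIntegrable_const (hI (by linarith) (by push_cast; linarith)) (fun t ht => by
            push_cast at ht
            have h0 := hpos t (by linarith [ht.1])
            have h1 : g (c + i + 2) ≤ g (t + 2) :=
              hg (by simp only [mem_Ici]; linarith) (by simp only [mem_Ici]; linarith [ht.1])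
                (by linarith [ht.1])
            have h2 : g t ≤ g (c + i + 1) :=
              hg (by simp only [mem_Ici]; linarith [ht.1]) (by simp only [mem_Ici]; linarith)
                (by linarith [ht.2])
            have h3 := hpos (c + i + 2) (by linarith)
            have h4 := h0.trans_le h2
            have h5 := h3.trans_le h1
            gcongr)
        refine le_trans (le_of_eq ?_) this
        rw [intervalIntegral.integral_const]
        push_cast
        simp
    _ = ∫ t in (c + (0 : ℕ))..(c + k), (g (t + 2) / g t) ^ e :=
        intervalIntegral.sum_integral_adjacent_intervals fun i _ => by
          have hi : (0 : ℝ) ≤ i := i.cast_nonneg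
          exact hI (by linarith) (by push_cast; linarith)
    _ ≤ _ := by
        rw [Nat.cast_zero, add_zero]
        refine intervalIntegral.integral_mono_interval ha (by linarith) hb ?_ (hI le_rfl (by linarith))
        filter_upwards [ae_restrict_mem measurableSet_Ioc] with t ht
        have h0 := hpos t (by linarith [ht.1])
        have h1 := hpos (t + 2) (by linarith [ht.1])
        simp only [Pi.zero_apply]
        positivity

/-! ### Comparison with the growth integral -/

/-- The double series that the chains lead to is dominated by a tail of the growth integral. -/
theorem tsum_le_lintegral_growthIntegrand {m n : ℕ} (hm : 2 ≤ m) (hn : 2 ≤ n) {φ ψ : ℝ → ℝ}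
    {s₀ s₁ N : ℕ} (hg : MonotoneOn (invComp ψ φ) (Ici ((s₁ : ℝ) + 1)))
    (hgpos : ∀ s : ℝ, s₁ + 1 ≤ s → 0 < invComp ψ φ s)
    (hφ : MonotoneOn φ (Ici ((s₁ : ℝ) + 1))) (hφpos : ∀ s : ℝ, s₁ + 1 ≤ s → 0 < φ s)
    (hN : sFive φ ψ s₀ s₁ + 3 ≤ N) :
    ∑' i : ℕ, (ENNReal.ofReal (invComp ψ φ (N + i + 1)) / ENNReal.ofReal (invComp ψ φ (N + i)) /
        ENNReal.ofReal (φ (N + i - s₀))) ^ (1 / ((m : ℝ) - 1)) *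
      (∑ k ∈ Finset.range (i + 1), (ENNReal.ofReal (invComp ψ φ (N + k + s₀ + 1)) /
        ENNReal.ofReal (invComp ψ φ (N + k + s₀))) ^ (1 / ((n : ℝ) - 1))) ^
          (((n : ℝ) - 1) / ((m : ℝ) - 1)) ≤
      ∫⁻ s in Ioi ((N : ℝ) - 1), ENNReal.ofReal (growthIntegrand m n φ ψ s₀ s₁ s) := by
  have hm' : (0 : ℝ) < m - 1 := by
    have : (2 : ℝ) ≤ m := by exact_mod_cast hm
    linarith
  have hn' : (0 : ℝ) < n - 1 := by
    have : (2 : ℝ) ≤ n := by exact_mod_cast hn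
    linarith
  have h5 : (s₀ : ℝ) + s₁ + 3 ≤ sFive φ ψ s₀ s₁ := le_max_left _ _
  have hs₀ : (0 : ℝ) ≤ s₀ := s₀.cast_nonneg
  set g := invComp ψ φ with hgdef
  set e : ℝ := 1 / ((n : ℝ) - 1) with he
  set e' : ℝ := 1 / ((m : ℝ) - 1) with he'
  have he0 : 0 ≤ e := by positivity
  have he0' : 0 ≤ e' := by positivity
  have hdisj : Pairwise (Function.onFun Disjoint
      fun i : ℕ => Ioc ((N : ℝ) - 1 + i) (N - 1 + i + 1)) := by
    have := pairwise_disjoint_Ioc_add_intCast ((N : ℝ) - 1)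
    intro i j hij
    have := this (show (i : ℤ) ≠ j by exact_mod_cast hij)
    simpa [Function.onFun] using this
  calc _ ≤ ∑' i : ℕ, ∫⁻ s in Ioc ((N : ℝ) - 1 + i) (N - 1 + i + 1),
        ENNReal.ofReal (growthIntegrand m n φ ψ s₀ s₁ s) := by
        refine ENNReal.tsum_le_tsum fun i => ?_
        have hi : (0 : ℝ) ≤ i := i.cast_nonneg
        have hvol : volume (Ioc ((N : ℝ) - 1 + i) (N - 1 + i + 1)) = 1 := by
          rw [Real.volume_Ioc]; simp
        have hconst : ∀ c : ENNReal, (∀ s ∈ Ioc ((N : ℝ) - 1 + i) (N - 1 + i + 1),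
            c ≤ ENNReal.ofReal (growthIntegrand m n φ ψ s₀ s₁ s)) →
            c ≤ ∫⁻ s in Ioc ((N : ℝ) - 1 + i) (N - 1 + i + 1),
              ENNReal.ofReal (growthIntegrand m n φ ψ s₀ s₁ s) := fun c hc => by
          calc c = ∫⁻ _ in Ioc ((N : ℝ) - 1 + i) (N - 1 + i + 1), c := by
                rw [setLIntegral_const, hvol, mul_one]
            _ ≤ _ := setLIntegral_mono' measurableSet_Ioc hc
        refine hconst _ fun s hs => ?_
        have hs1 := hs.1
        have hs2 := hs.2
        have p1 := hgpos s (by linarith)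
        have p2 := hgpos (s + 2) (by linarith)
        have p3 := hφpos (s - s₀) (by linarith)
        have p4 := hgpos (N + i) (by linarith)
        have p5 := hgpos (N + i + 1) (by linarith)
        have p6 := hφpos (N + i - s₀) (by linarith)
        have q1 : g (N + i + 1) ≤ g (s + 2) :=
          hg (by simp only [mem_Ici]; linarith) (by simp only [mem_Ici]; linarith) (by linarith)
        have q2 : g s ≤ g (N + i) :=
          hg (by simp only [mem_Ici]; linarith) (by simp only [mem_Ici]; linarith) (by linarith)
        have q3 : φ (s - s₀) ≤ φ (N + i - s₀) :=
          hφ (by simp only [mem_Ici]; linarith) (by simp only [mem_Ici]; linarith) (by linarith)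
        rw [growthIntegrand, ← hgdef, ← he, ← he', ENNReal.ofReal_mul (by positivity)]
        have hsum := sum_div_rpow_le_integral hg hgpos he0 (a := sFive φ ψ s₀ s₁ + s₀ + 2)
          (b := s + s₀ + 2) (c := N + s₀ - 1) (k := i + 1) (by linarith) (by linarith)
          (by push_cast; linarith)
        have hterm : ∀ k : ℕ, 0 < g (N + k + s₀ + 1) ∧ 0 < g (N + k + s₀) := fun k => by
          have hk : (0 : ℝ) ≤ k := k.cast_nonneg
          exact ⟨hgpos _ (by linarith), hgpos _ (by linarith)⟩
        have hsum' : ∑ k ∈ Finset.range (i + 1), (g (N + k + s₀ + 1) / g (N + k + s₀)) ^ e ≤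
            ∫ t in (sFive φ ψ s₀ s₁ + s₀ + 2)..(s + s₀ + 2), (g (t + 2) / g t) ^ e := by
          refine le_trans (le_of_eq (Finset.sum_congr rfl fun k _ => ?_)) hsum
          ring_nf
        have hsum0 : 0 ≤ ∑ k ∈ Finset.range (i + 1), (g (N + k + s₀ + 1) / g (N + k + s₀)) ^ e :=
          Finset.sum_nonneg fun k _ => Real.rpow_nonneg
            (div_nonneg (hterm k).1.le (hterm k).2.le) _
        refine mul_le_mul' ?_ ?_
        · rw [← ENNReal.ofReal_div_of_pos p4, ← ENNReal.ofReal_div_of_pos p6,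
            ENNReal.ofReal_rpow_of_nonneg (by positivity) he0']
          refine ENNReal.ofReal_le_ofReal ?_
          rw [mul_one_div]
          gcongr
        · rw [← ENNReal.ofReal_rpow_of_nonneg (hsum0.trans hsum') (by positivity)]
          refine ENNReal.rpow_le_rpow ?_ (by positivity)
          refine le_trans (le_of_eq ?_) (ENNReal.ofReal_le_ofReal hsum')
          rw [ENNReal.ofReal_sum_of_nonneg fun k _ => Real.rpow_nonneg
            (div_nonneg (hterm k).1.le (hterm k).2.le) _]
          refine Finset.sum_congr rfl fun k _ => ?_
          rw [← ENNReal.ofReal_div_of_pos (hterm k).2, ENNReal.ofReal_rpow_of_nonneg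
            (div_nonneg (hterm k).1.le (hterm k).2.le) he0]
    _ = ∫⁻ s in ⋃ i : ℕ, Ioc ((N : ℝ) - 1 + i) (N - 1 + i + 1),
        ENNReal.ofReal (growthIntegrand m n φ ψ s₀ s₁ s) :=
        (lintegral_iUnion (fun _ => measurableSet_Ioc) hdisj _).symm
    _ ≤ _ := by
        refine lintegral_mono_set (iUnion_subset fun i s hs => ?_)
        have hi : (0 : ℝ) ≤ i := i.cast_nonneg
        rw [mem_Ioi]
        linarith [hs.1]

theorem tendsto_lintegral_Ioi_natCast_sub_one {f : ℝ → ℝ} {a : ℝ} (hf : IntegrableOn f (Ioi a)) :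
    Tendsto (fun N : ℕ => ∫⁻ s in Ioi ((N : ℝ) - 1), ENNReal.ofReal (f s)) atTop (𝓝 0) := by
  have hfin : ∫⁻ s in Ioi a, ENNReal.ofReal (f s) ≠ ⊤ := by
    refine ne_top_of_le_ne_top hf.2.ne (lintegral_mono fun s => ?_)
    exact Real.ofReal_le_enorm _
  have h0 : Tendsto (fun N : ℕ => (volume.restrict (Ioi a)).withDensity
      (fun s => ENNReal.ofReal (f s)) (Ioi ((N : ℝ) - 1))) atTop (𝓝 0) := by
    have := tendsto_measure_iInter_atTop (μ := (volume.restrict (Ioi a)).withDensity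
      (fun s => ENNReal.ofReal (f s))) (s := fun N : ℕ => Ioi ((N : ℝ) - 1))
      (fun _ => measurableSet_Ioi.nullMeasurableSet)
      (fun i j hij => Ioi_subset_Ioi (by gcongr)) ⟨0, by
        rw [withDensity_apply _ measurableSet_Ioi]
        exact ne_top_of_le_ne_top hfin (setLIntegral_le_lintegral _ _)⟩
    rwa [show (⋂ N : ℕ, Ioi ((N : ℝ) - 1)) = ∅ by
      refine eq_empty_of_forall_notMem fun x hx => ?_
      obtain ⟨k, hk⟩ := exists_nat_gt (x + 1)
      have := mem_iInter.1 hx k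
      rw [mem_Ioi] at this
      linarith, measure_empty] at this
  refine h0.congr' ?_
  filter_upwards [eventually_ge_atTop (⌈a⌉₊ + 1)] with N hN
  rw [withDensity_apply _ measurableSet_Ioi, Measure.restrict_restrict measurableSet_Ioi]
  congr 2
  refine inter_eq_left.2 (Ioi_subset_Ioi ?_)
  have h1 : ((⌈a⌉₊ + 1 : ℕ) : ℝ) ≤ N := by exact_mod_cast hN
  have h2 := Nat.le_ceil a
  push_cast at h1
  linarith

/-! ### Local boundedness from separate mean value inequalities -/

/-- Local boundedness of a function `v` with the mean value inequality in each variable, in terms of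
abstract levels `γ l`. The density `Ψ` has a finite integral over the product of the balls, and is
at least `f l` wherever `v` is at least `γ l`. -/
theorem exists_bound_of_separate_mean_value {E F : Type*}
    [NormedAddCommGroup E] [InnerProductSpace ℝ E] [FiniteDimensional ℝ E] [MeasurableSpace E]
    [BorelSpace E] [NormedAddCommGroup F] [InnerProductSpace ℝ F] [FiniteDimensional ℝ F]
    [MeasurableSpace F] [BorelSpace F] {m n : ℕ} (hm : Module.finrank ℝ E = m)
    (hn : Module.finrank ℝ F = n) (hn2 : 2 ≤ n) (hmn : n ≤ m)
    {K : ENNReal} (hK0 : K ≠ 0) (hKt : K ≠ ⊤) {γ f : ℕ → ENNReal} {p : ℕ}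
    (hγ : Monotone γ) (hγ0 : ∀ l, γ l ≠ 0) (hγt : ∀ l, γ l ≠ ⊤)
    (hstep : ∀ l, 2 * K * γ l ≤ γ (l + p)) (hlim : Tendsto γ atTop (𝓝 ⊤))
    (hf0 : ∀ l, f l ≠ 0) (hft : ∀ l, f l ≠ ⊤)
    (hsmall : ∀ ε : ENNReal, ε ≠ 0 → ∃ M : ℕ,
      ∑' i : ℕ, (γ (M + p + i + 1) / γ (M + p + i) / f (M + i)) ^ (1 / ((m : ℝ) - 1)) *
        (∑ k ∈ Finset.range (i + 1), (γ (M + p + k + p + 1) / γ (M + p + k + p)) ^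
          (1 / ((n : ℝ) - 1))) ^ (((n : ℝ) - 1) / ((m : ℝ) - 1)) ≤ ε)
    {v Ψ : E → F → ENNReal} {a : E} {b : F} {ρ : ℝ} (hρ : 0 < ρ)
    (hmx : ∀ y ∈ ball b (2 * ρ), AEMeasurable (fun x => v x y) (volume.restrict (ball a (2 * ρ))))
    (hmy : ∀ x ∈ ball a (2 * ρ), AEMeasurable (fun y => v x y) (volume.restrict (ball b (2 * ρ))))
    (hvx : ∀ y ∈ ball b (2 * ρ), ∀ x r, 0 < r → closedBall x r ⊆ ball a (2 * ρ) →
      v x y ≤ K / volume (ball x r) * ∫⁻ x' in ball x r, v x' y)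
    (hvy : ∀ x ∈ ball a (2 * ρ), ∀ y r, 0 < r → closedBall y r ⊆ ball b (2 * ρ) →
      v x y ≤ K / volume (ball y r) * ∫⁻ y' in ball y r, v x y')
    (hbx : ∀ y ∈ ball b (2 * ρ), ∃ C : ENNReal, C ≠ ⊤ ∧ ∀ x ∈ ball a (2 * ρ), v x y ≤ C)
    (hby : ∀ x ∈ ball a (2 * ρ), ∃ C : ENNReal, C ≠ ⊤ ∧ ∀ y ∈ ball b (2 * ρ), v x y ≤ C)
    (hΨ : ∀ x ∈ ball a (2 * ρ), ∀ y ∈ ball b (2 * ρ), ∀ l, γ l ≤ v x y → f l ≤ Ψ x y)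
    (hI : ∫⁻ y in ball b (2 * ρ), ∫⁻ x in ball a (2 * ρ), Ψ x y ≠ ⊤) :
    ∃ C : ENNReal, C ≠ ⊤ ∧ ∀ x ∈ ball a ρ, ∀ y ∈ ball b ρ, v x y ≤ C := by
  have hn' : (0 : ℝ) < n - 1 := by
    have : (2 : ℝ) ≤ n := by exact_mod_cast hn2
    linarith
  have hnm' : (n : ℝ) - 1 ≤ m - 1 := by
    have : (n : ℝ) ≤ m := by exact_mod_cast hmn
    linarith
  have hm' : (0 : ℝ) < m - 1 := hn'.trans_le hnm'
  set q : ℝ := ((m : ℝ) - 1) / (n - 1) with hq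
  have hq1 : 1 ≤ q := (one_le_div hn').2 hnm'
  have hq0 : 0 < q := by linarith
  have h1q : ((n : ℝ) - 1) / (m - 1) = 1 / q := by rw [hq, one_div_div]
  set I := ∫⁻ y in ball b (2 * ρ), ∫⁻ x in ball a (2 * ρ), Ψ x y
  set νE := volume (ball (0 : E) 1)
  set νF := volume (ball (0 : F) 1)
  have hE0 : νE ≠ 0 := (measure_ball_pos volume (0 : E) one_pos).ne'
  have hEt : νE ≠ ⊤ := measure_ball_lt_top.ne
  have hF0 : νF ≠ 0 := (measure_ball_pos volume (0 : F) one_pos).ne'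
  set RE := ENNReal.ofReal ρ ^ (m : ℝ)
  set RF := ENNReal.ofReal ρ ^ (n : ℝ)
  have hRE0 : RE ≠ 0 := by simp [RE, hρ]
  have hREt : RE ≠ ⊤ := ENNReal.rpow_ne_top_of_nonneg (by positivity) ENNReal.ofReal_ne_top
  have hRF0 : RF ≠ 0 := by simp [RF, hρ]
  set CE := 2 * K / νE * (p + 1)
  have hCE0 : CE ≠ 0 := by
    simp [CE, ENNReal.div_eq_zero_iff, hK0, hEt]
  have hCEt : CE ≠ ⊤ := by
    refine ENNReal.mul_ne_top (ENNReal.div_ne_top (ENNReal.mul_ne_top (by simp) hKt) hE0) (by simp)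
  set D := 2 * K / νF * ((p + 1) * I) * (CE / RE)
  have hDt : D ≠ ⊤ := by
    refine ENNReal.mul_ne_top (ENNReal.mul_ne_top (ENNReal.div_ne_top
      (ENNReal.mul_ne_top (by simp) hKt) hF0) (ENNReal.mul_ne_top (by simp) hI))
      (ENNReal.div_ne_top hCEt hRE0)
  obtain ⟨ε, hε0, hεt, hε⟩ : ∃ ε : ENNReal, ε ≠ 0 ∧ ε ≠ ⊤ ∧ D * ε ^ ((m : ℝ) - 1) < RF := by
    have hcont : Continuous fun ε : ENNReal => D * ε ^ ((m : ℝ) - 1) :=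
      (ENNReal.continuous_const_mul hDt).comp ENNReal.continuous_rpow_const
    have h0 : Tendsto (fun ε : ENNReal => D * ε ^ ((m : ℝ) - 1)) (𝓝[>] 0) (𝓝 0) := by
      have := (hcont.tendsto 0).mono_left (nhdsWithin_le_nhds (s := Ioi 0))
      simpa [ENNReal.zero_rpow_of_pos hm'] using this
    obtain ⟨ε, h1, h2, h3⟩ := ((h0.eventually_lt_const (pos_iff_ne_zero.2 hRF0)).and
      ((eventually_mem_nhdsWithin (a := (0 : ENNReal)) (s := Ioi 0)).and
        (nhdsWithin_le_nhds (eventually_lt_nhds ENNReal.zero_lt_top)))).exists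
    exact ⟨ε, (pos_iff_ne_zero.1 h2), h3.ne, h1⟩
  obtain ⟨M, hM⟩ := hsmall ε hε0
  set τ : ℕ → ENNReal := fun i =>
    (γ (M + p + i + 1) / γ (M + p + i) / f (M + i)) ^ (1 / ((m : ℝ) - 1)) with hτ
  set ω : ℕ → ENNReal := fun k =>
    (γ (M + p + k + p + 1) / γ (M + p + k + p)) ^ (1 / ((n : ℝ) - 1)) with hω
  set T : ℕ → ENNReal := fun k => ∑' i, τ (k + i)
  set S := ∑' k, ω k * T k ^ q with hSdef
  -- Minkowski's inequality, available because `n ≤ m` gives `1 ≤ q`.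
  have hS : S ^ (1 / q) ≤ ε := by
    refine (ENNReal.tsum_mul_tail_rpow_le hq1 τ ω).trans ?_
    rw [← h1q]
    exact hM
  have hSt : S ≠ ⊤ := by
    intro h
    rw [h, ENNReal.top_rpow_of_pos (by positivity), top_le_iff] at hS
    exact hεt hS
  have hω0 : ∀ k, ω k ≠ 0 := fun k => by
    rw [hω, Ne, ENNReal.rpow_eq_zero_iff_of_pos (by positivity)]
    simp [ENNReal.div_eq_zero_iff, hγ0, hγt]
  have hτ0 : ∀ k, τ k ≠ 0 := fun k => by
    rw [hτ, Ne, ENNReal.rpow_eq_zero_iff_of_pos (by positivity)]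
    simp [ENNReal.div_eq_zero_iff, hγ0, hγt, hft]
  have hTt : ∀ k, T k ≠ ⊤ := by
    intro k hk
    refine hSt (top_le_iff.1 (le_trans ?_ (ENNReal.le_tsum k)))
    rw [hk, ENNReal.top_rpow_of_pos hq0, ENNReal.mul_top (hω0 k)]
  have hT0 : ∀ k, T k ≠ 0 := fun k h => hτ0 (k + 0) (ENNReal.tsum_eq_zero.1 h 0)
  set Q : ℕ → ENNReal := fun k => CE * T k ^ ((m : ℝ) - 1)
  have hQ0 : ∀ k, Q k ≠ 0 := fun k =>
    mul_ne_zero hCE0 (by simp [ENNReal.rpow_eq_zero_iff, hT0, hTt])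
  have hQt : ∀ k, Q k ≠ ⊤ := fun k =>
    ENNReal.mul_ne_top hCEt (ENNReal.rpow_ne_top_of_nonneg hm'.le (hTt k))
  refine ⟨γ (M + p + p), hγt _, fun x₀ hx₀ y₀ hy₀ => ?_⟩
  by_contra! hlt
  have hsubE : ball x₀ ρ ⊆ ball a (2 * ρ) :=
    ball_subset_ball' (by rw [mem_ball] at hx₀; linarith)
  have hsubF : ball y₀ ρ ⊆ ball b (2 * ρ) :=
    ball_subset_ball' (by rw [mem_ball] at hy₀; linarith)
  have hx₀' : x₀ ∈ ball a (2 * ρ) := hsubE (mem_ball_self hρ)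
  -- If `v x₀ y` is at least the level `M + p + k`, a chain in `x` starting at `x₀` shows that the
  -- slice over `y` carries a mass of at least `RE / Q k`.
  have hslice : ∀ k, ∀ y ∈ ball y₀ ρ, γ (M + p + k) ≤ v x₀ y →
      RE / Q k ≤ ∫⁻ x in ball a (2 * ρ), Ψ x y := by
    intro k y hy hvk
    have hy2 := hsubF hy
    obtain ⟨C, hC, hCb⟩ := hbx y hy2
    have key := ofReal_radius_rpow_le (p := p) hm (hn2.trans hmn)
      ((hmx y hy2).mono_measure (Measure.restrict_mono hsubE le_rfl))
      (fun x r hr hxr => hvx y hy2 x r hr (hxr.trans hsubE)) hC (fun x hx => hCb x (hsubE hx))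
      (g := fun i => γ (M + k + i)) (fun i j hij => hγ (by omega)) (fun i => hγ0 _)
      (fun i => hγt _) (fun i => by simpa [add_assoc] using hstep (M + k + i))
      (hlim.comp (tendsto_atTop_mono (fun i => Nat.le_add_left _ _) tendsto_id))
      (by rwa [add_right_comm]) (P := fun x => Ψ x y) (c := fun i => f (M + k + i))
      (fun i => hf0 _) (fun i => hft _) (fun i x hx h => hΨ x (hsubE hx) y hy2 _ h)
    refine ENNReal.div_le_of_le_mul' ?_
    refine key.trans ?_
    have hTk : ∑' i, (γ (M + k + (i + p + 1)) / γ (M + k + (i + p)) / f (M + k + i)) ^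
        (1 / ((m : ℝ) - 1)) = T k := by
      refine tsum_congr fun i => ?_
      simp only [hτ]
      rw [show M + k + (i + p + 1) = M + p + (k + i) + 1 by omega,
        show M + k + (i + p) = M + p + (k + i) by omega, add_assoc M k i]
    rw [hTk]
    calc _ ≤ 2 * K / νE * ((p + 1) * ∫⁻ x in ball a (2 * ρ), Ψ x y) * T k ^ ((m : ℝ) - 1) := by
          gcongr
      _ = _ := by simp only [Q, CE]; ring
  -- A chain in `y` starting at `y₀`, with the masses of the slices as density.
  obtain ⟨C, hC, hCb⟩ := hby x₀ hx₀'
  have key := ofReal_radius_rpow_le (p := p) hn hn2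
    ((hmy x₀ hx₀').mono_measure (Measure.restrict_mono hsubF le_rfl))
    (fun y r hr hyr => hvy x₀ hx₀' y r hr (hyr.trans hsubF)) hC
    (fun y hy => hCb y (hsubF hy))
    (g := fun k => γ (M + p + k)) (fun i j hij => hγ (by omega)) (fun i => hγ0 _)
    (fun i => hγt _) (fun i => by simpa [add_assoc] using hstep (M + p + i))
    (hlim.comp (tendsto_atTop_mono (fun i => Nat.le_add_left _ _) tendsto_id))
    hlt.le (P := fun y => ∫⁻ x in ball a (2 * ρ), Ψ x y) (c := fun k => RE / Q k)
    (fun k => by simp [ENNReal.div_eq_zero_iff, hRE0, hQt])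
    (fun k => ENNReal.div_ne_top hREt (hQ0 k)) hslice
  have hsum : ∑' k, (γ (M + p + (k + p + 1)) / γ (M + p + (k + p)) / (RE / Q k)) ^
      (1 / ((n : ℝ) - 1)) = (CE / RE) ^ (1 / ((n : ℝ) - 1)) * S := by
    rw [hSdef, ← ENNReal.tsum_mul_left]
    refine tsum_congr fun k => ?_
    have h1 : γ (M + p + (k + p + 1)) / γ (M + p + (k + p)) / (RE / Q k) =
        CE / RE * ((γ (M + p + k + p + 1) / γ (M + p + k + p)) * T k ^ ((m : ℝ) - 1)) := by
      rw [show M + p + (k + p + 1) = M + p + k + p + 1 by omega,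
        show M + p + (k + p) = M + p + k + p by omega]
      generalize γ (M + p + k + p + 1) / γ (M + p + k + p) = z
      rw [div_eq_mul_inv z, ENNReal.inv_div (Or.inl (hQt k)) (Or.inl (hQ0 k))]
      simp only [Q, div_eq_mul_inv]; ring
    rw [h1, ENNReal.mul_rpow_of_nonneg _ _ (by positivity),
      ENNReal.mul_rpow_of_nonneg _ _ (by positivity), ← ENNReal.rpow_mul, mul_one_div]
  rw [hsum] at key
  refine absurd hε (not_lt.2 (key.trans ?_))
  calc _ ≤ 2 * K / νF * ((p + 1) * I) * ((CE / RE) ^ (1 / ((n : ℝ) - 1)) * S) ^ ((n : ℝ) - 1) := by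
        gcongr
        exact lintegral_mono_set hsubF
    _ = D * (S ^ (1 / q)) ^ ((m : ℝ) - 1) := by
        rw [ENNReal.mul_rpow_of_nonneg _ _ hn'.le, ← ENNReal.rpow_mul, one_div_mul_cancel hn'.ne',
          ENNReal.rpow_one, ← ENNReal.rpow_mul, show 1 / q * ((m : ℝ) - 1) = n - 1 by
            rw [hq]; field_simp]
        simp only [D]; ring
    _ ≤ _ := by gcongr

/-! ### Quasinearly subharmonic functions on slices and products -/

theorem truncShift_zero_eq_ofReal {E : Type*} {u : E → EReal} {x : E} (hx : u x < ⊤) :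
    truncShift u 0 x = ENNReal.ofReal (realPosPart u x) := by
  have h : max (u x) 0 ≠ ⊤ := (max_lt hx EReal.zero_lt_top).ne
  simp only [truncShift, realPosPart, neg_zero, EReal.coe_zero, add_zero]
  rw [EReal.toENNReal_of_ne_top h]

theorem aemeasurable_truncShift {E : Type*} [MeasurableSpace E] {μ : Measure E} {u : E → EReal}
    (hu : NullMeasurable u μ) (M : ℝ) : AEMeasurable (truncShift u M) μ := by
  have h : Measurable fun e : EReal => (max e ((-M : ℝ) : EReal) + (M : EReal)).toENNReal := by
    fun_prop
  exact h.comp_aemeasurable hu.aemeasurable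

theorem aemeasurable_realPosPart {E : Type*} [MeasurableSpace E] {μ : Measure E} {u : E → EReal}
    (hu : NullMeasurable u μ) : AEMeasurable (realPosPart u) μ := by
  have h : Measurable fun e : EReal => (max e 0).toReal := by fun_prop
  exact h.comp_aemeasurable hu.aemeasurable

/-- A quasinearly subharmonic function is locally bounded above. -/
theorem IsKQuasinearlySubharmonicOn.exists_bound {E : Type*} [NormedAddCommGroup E]
    [InnerProductSpace ℝ E] [FiniteDimensional ℝ E] [MeasurableSpace E] [BorelSpace E]
    {K : ℝ} {u : E → EReal} {D : Set E} (hu : IsKQuasinearlySubharmonicOn K u D) {a : E} {ρ : ℝ}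
    (hρ : 0 < ρ) (hD : closedBall a (3 * ρ) ⊆ D) :
    ∃ C : ENNReal, C ≠ ⊤ ∧ ∀ x ∈ ball a (2 * ρ), truncShift u 0 x ≤ C := by
  have hfin : ∫⁻ y in closedBall a (3 * ρ), truncShift u 0 y ≠ ⊤ := by
    have hint : IntegrableOn (realPosPart u) (closedBall a (3 * ρ)) :=
      hu.locallyIntegrable_realPosPart.integrableOn_compact_subset hD (isCompact_closedBall _ _)
    refine ne_top_of_le_ne_top hint.2.ne (setLIntegral_mono' measurableSet_closedBall fun y hy => ?_)
    rw [truncShift_zero_eq_ofReal (hu.lt_top y (hD hy))]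
    exact Real.ofReal_le_enorm _
  refine ⟨ENNReal.ofReal K / volume (ball a ρ) * ∫⁻ y in closedBall a (3 * ρ), truncShift u 0 y,
    ENNReal.mul_ne_top (ENNReal.div_ne_top ENNReal.ofReal_ne_top
      (measure_ball_pos volume a hρ).ne') hfin, fun x hx => ?_⟩
  have hsub : closedBall x ρ ⊆ closedBall a (3 * ρ) :=
    closedBall_subset_closedBall' (by rw [mem_ball] at hx; linarith)
  refine (hu.mean_value x ρ hρ (hsub.trans hD) 0 le_rfl).trans ?_
  rw [Measure.addHaar_ball_center volume x, Measure.addHaar_ball_center volume a]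
  gcongr
  exact ball_subset_closedBall.trans hsub

theorem WithLp.dist_prod_le {E F : Type*} [NormedAddCommGroup E] [NormedAddCommGroup F]
    (z w : WithLp 2 (E × F)) :
    dist z w ≤ dist z.fst w.fst + dist z.snd w.snd := by
  rw [WithLp.prod_dist_eq_of_L2]
  refine Real.sqrt_le_iff.2 ⟨by positivity, ?_⟩
  nlinarith [@dist_nonneg _ _ z.fst w.fst, @dist_nonneg _ _ z.snd w.snd]

section Product

variable {E F : Type*} [NormedAddCommGroup E] [InnerProductSpace ℝ E] [FiniteDimensional ℝ E]
  [MeasurableSpace E] [BorelSpace E] [NormedAddCommGroup F] [InnerProductSpace ℝ F]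
  [FiniteDimensional ℝ F] [MeasurableSpace F] [BorelSpace F]

/-- Tonelli's theorem on a product set in the `L²` product, in both orders of integration. -/
theorem setLIntegral_withLp_prod {s : Set E} {t : Set F}
    {f : WithLp 2 (E × F) → ENNReal}
    (hf : AEMeasurable f (volume.restrict (WithLp.ofLp ⁻¹' s ×ˢ t))) :
    ∫⁻ z in WithLp.ofLp ⁻¹' s ×ˢ t, f z = ∫⁻ x in s, ∫⁻ y in t, f (WithLp.toLp 2 (x, y)) ∧
    ∫⁻ z in WithLp.ofLp ⁻¹' s ×ˢ t, f z = ∫⁻ y in t, ∫⁻ x in s, f (WithLp.toLp 2 (x, y)) := by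
  have hmp := WithLp.volume_preserving_toLp E F
  have hemb : MeasurableEmbedding (WithLp.toLp 2 : E × F → WithLp 2 (E × F)) :=
    (MeasurableEquiv.toLp 2 (E × F)).measurableEmbedding
  have hpre : (WithLp.toLp 2 : E × F → WithLp 2 (E × F)) ⁻¹' (WithLp.ofLp ⁻¹' s ×ˢ t) = s ×ˢ t :=
    rfl
  have hmp' := hmp.restrict_preimage_emb hemb (WithLp.ofLp ⁻¹' s ×ˢ t)
  rw [hpre] at hmp'
  have hf' : AEMeasurable (fun z : E × F => f (WithLp.toLp 2 z))
      ((volume.restrict s).prod (volume.restrict t)) := by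
    rw [Measure.prod_restrict, ← Measure.volume_eq_prod]
    exact hf.comp_quasiMeasurePreserving hmp'.quasiMeasurePreserving
  have h1 : ∫⁻ z in WithLp.ofLp ⁻¹' s ×ˢ t, f z =
      ∫⁻ z, f (WithLp.toLp 2 z) ∂((volume.restrict s).prod (volume.restrict t)) := by
    rw [Measure.prod_restrict, ← Measure.volume_eq_prod]
    exact (hmp'.lintegral_comp_emb hemb f).symm
  exact ⟨h1.trans (lintegral_prod _ hf'), h1.trans (lintegral_prod_symm _ hf')⟩

/-- The mean value inequality in the product space, from the ones in the two variables: the product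
of the balls of radius `r / 2` lies between the balls of radius `r / 2` and `r`. No integrability is
needed, as all the integrands are nonnegative. -/
theorem truncShift_le_of_separate {K : ℝ} {Ω : Set (WithLp 2 (E × F))}
    {u : WithLp 2 (E × F) → EReal} (hu : NullMeasurable u (volume.restrict Ω))
    (hx : ∀ y : F, IsKQuasinearlySubharmonicOn K (fun x : E => u (WithLp.toLp 2 (x, y)))
      {x | WithLp.toLp 2 (x, y) ∈ Ω})
    (hy : ∀ x : E, IsKQuasinearlySubharmonicOn K (fun y : F => u (WithLp.toLp 2 (x, y)))
      {y | WithLp.toLp 2 (x, y) ∈ Ω})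
    {z : WithLp 2 (E × F)} {r : ℝ} (hr : 0 < r) (hz : closedBall z r ⊆ Ω) {M : ℝ} (hM : 0 ≤ M) :
    truncShift u M z ≤ ENNReal.ofReal (K ^ 2 * 2 ^ Module.finrank ℝ (WithLp 2 (E × F))) /
      volume (ball z r) * ∫⁻ w in ball z r, truncShift u M w := by
  set d := Module.finrank ℝ (WithLp 2 (E × F))
  set a := z.fst
  set b := z.snd
  have hr2 : 0 < r / 2 := by positivity
  have hcl : ∀ x ∈ closedBall a (r / 2), ∀ y ∈ closedBall b (r / 2), WithLp.toLp 2 (x, y) ∈ Ω := by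
    intro x hx y hy
    refine hz (mem_closedBall.2 ((WithLp.dist_prod_le _ _).trans ?_))
    rw [mem_closedBall] at hx hy
    change dist x a + dist y b ≤ r
    linarith
  set S : Set (WithLp 2 (E × F)) := WithLp.ofLp ⁻¹' ball a (r / 2) ×ˢ ball b (r / 2)
  have hSball : S ⊆ ball z r := by
    rintro w ⟨h1, h2⟩
    refine mem_ball.2 ((WithLp.dist_prod_le _ _).trans_lt ?_)
    rw [mem_ball] at h1 h2
    change dist w.fst a + dist w.snd b < r
    change dist w.fst a < _ at h1
    change dist w.snd b < _ at h2
    linarith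
  have hfm : AEMeasurable (truncShift u M) (volume.restrict S) :=
    (aemeasurable_truncShift hu M).mono_measure
      (Measure.restrict_mono ((hSball.trans ball_subset_closedBall).trans hz) le_rfl)
  set VE := volume (ball a (r / 2))
  set VF := volume (ball b (r / 2))
  have hVE0 : VE ≠ 0 := (measure_ball_pos volume a hr2).ne'
  have hVF0 : VF ≠ 0 := (measure_ball_pos volume b hr2).ne'
  have hVEt : VE ≠ ⊤ := measure_ball_lt_top.ne
  have hVFt : VF ≠ ⊤ := measure_ball_lt_top.ne
  have hvol : VE * VF = volume S := by
    have := (setLIntegral_withLp_prod (f := fun _ => 1) (s := ball a (r / 2))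
      (t := ball b (r / 2)) aemeasurable_const).1
    simp only [setLIntegral_const, one_mul] at this
    rw [this, mul_comm]
  have hhalf : volume (ball z r) = 2 ^ d * volume (ball z (r / 2)) := by
    rw [Measure.addHaar_ball_of_pos _ _ hr, Measure.addHaar_ball_of_pos _ _ hr2, ← mul_assoc]
    congr 1
    rw [show (2 : ENNReal) ^ d = ENNReal.ofReal (2 ^ d) by
      rw [ENNReal.ofReal_pow (by norm_num)]; norm_num,
      ← ENNReal.ofReal_mul (by positivity), ← mul_pow]
    congr 2; ring
  have hballS : ball z (r / 2) ⊆ S := by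
    intro w hw
    rw [mem_ball, WithLp.prod_dist_eq_of_L2] at hw
    have h1 := Real.lt_sq_of_sqrt_lt hw
    refine ⟨?_, ?_⟩
    · change dist w.fst z.fst < r / 2
      nlinarith [@dist_nonneg _ _ w.fst z.fst, sq_nonneg (dist w.snd z.snd)]
    · change dist w.snd z.snd < r / 2
      nlinarith [@dist_nonneg _ _ w.snd z.snd, sq_nonneg (dist w.fst z.fst)]
  have hV : volume (ball z r) ≤ 2 ^ d * (VE * VF) := by
    rw [hhalf, hvol]
    gcongr
  have hz0 : volume (ball z r) ≠ 0 := (measure_ball_pos volume z hr).ne'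
  have hzt : volume (ball z r) ≠ ⊤ := measure_ball_lt_top.ne
  have hconst : ENNReal.ofReal K / VE * (ENNReal.ofReal K / VF) ≤
      ENNReal.ofReal K ^ 2 * 2 ^ d / volume (ball z r) := by
    rw [ENNReal.le_div_iff_mul_le (Or.inl hz0) (Or.inl hzt)]
    calc _ ≤ ENNReal.ofReal K / VE * (ENNReal.ofReal K / VF) * (2 ^ d * (VE * VF)) := by gcongr
      _ = ENNReal.ofReal K ^ 2 * 2 ^ d * (VE * VE⁻¹) * (VF * VF⁻¹) := by
          simp only [div_eq_mul_inv]; ring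
      _ = _ := by
          rw [ENNReal.mul_inv_cancel hVE0 hVEt, ENNReal.mul_inv_cancel hVF0 hVFt, mul_one, mul_one]
  have hK2 : ENNReal.ofReal K ^ 2 * 2 ^ d ≤ ENNReal.ofReal (K ^ 2 * 2 ^ d) := by
    rw [ENNReal.ofReal_mul (by positivity), ENNReal.ofReal_pow (by norm_num : (0 : ℝ) ≤ 2),
      ENNReal.ofReal_ofNat]
    gcongr
    rcases le_total 0 K with h | h
    · rw [ENNReal.ofReal_pow h]
    · simp [ENNReal.ofReal_of_nonpos h]
  calc truncShift u M z ≤ ENNReal.ofReal K / VE *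
        ∫⁻ x in ball a (r / 2), truncShift u M (WithLp.toLp 2 (x, b)) :=
        (hx b).mean_value a (r / 2) hr2
          (fun x hx => hcl x hx b (mem_closedBall_self hr2.le)) M hM
    _ ≤ ENNReal.ofReal K / VE * ∫⁻ x in ball a (r / 2), ENNReal.ofReal K / VF *
        ∫⁻ y in ball b (r / 2), truncShift u M (WithLp.toLp 2 (x, y)) := by
        gcongr _ * ?_
        exact setLIntegral_mono' measurableSet_ball fun x hx =>
          (hy x).mean_value b (r / 2) hr2
            (fun y hy => hcl x (ball_subset_closedBall hx) y hy) M hM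
    _ = ENNReal.ofReal K / VE * (ENNReal.ofReal K / VF) * ∫⁻ w in S, truncShift u M w := by
        rw [lintegral_const_mul' _ _ (ENNReal.div_ne_top ENNReal.ofReal_ne_top hVF0),
          (setLIntegral_withLp_prod hfm).1, mul_assoc]
    _ ≤ _ := by
        gcongr ?_ * ?_
        · refine hconst.trans ?_
          gcongr
        · exact lintegral_mono_set hSball

end Product

/-! ### Separately quasinearly subharmonic functions -/

/-- The double series over the levels `γ l = (ψ⁻¹ ∘ φ) (N₀ + l)`, with `f l = φ (N₀ + l)`, is
arbitrarily small if it begins at a high enough level. -/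
theorem exists_small_tsum {m n : ℕ} (hm : 2 ≤ m) (hn : 2 ≤ n) {φ ψ : ℝ → ℝ} {s₀ s₁ N₀ : ℕ}
    (hg : MonotoneOn (invComp ψ φ) (Ici ((s₁ : ℝ) + 1)))
    (hgpos : ∀ s : ℝ, s₁ + 1 ≤ s → 0 < invComp ψ φ s)
    (hφ : MonotoneOn φ (Ici ((s₁ : ℝ) + 1))) (hφpos : ∀ s : ℝ, s₁ + 1 ≤ s → 0 < φ s)
    (hc3 : IntegrableOn (growthIntegrand m n φ ψ s₀ s₁) (Ioi (sFive φ ψ s₀ s₁)) volume)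
    {γ f : ℕ → ENNReal} (hγ : γ = fun l : ℕ => ENNReal.ofReal (invComp ψ φ (N₀ + l : ℕ)))
    (hf : f = fun l : ℕ => ENNReal.ofReal (φ (N₀ + l : ℕ))) {ε : ENNReal} (hε : ε ≠ 0) :
    ∃ M : ℕ, ∑' i : ℕ,
      (γ (M + s₀ + i + 1) / γ (M + s₀ + i) / f (M + i)) ^ (1 / ((m : ℝ) - 1)) *
        (∑ k ∈ Finset.range (i + 1), (γ (M + s₀ + k + s₀ + 1) / γ (M + s₀ + k + s₀)) ^
          (1 / ((n : ℝ) - 1))) ^ (((n : ℝ) - 1) / ((m : ℝ) - 1)) ≤ ε := by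
  have h1 := (tendsto_lintegral_Ioi_natCast_sub_one hc3).comp
    (tendsto_atTop_mono (fun M => (by omega : M ≤ N₀ + M + s₀)) tendsto_id)
  obtain ⟨M, hM1, hM2⟩ := ((h1.eventually_le_const (pos_iff_ne_zero.2 hε)).and
    (eventually_ge_atTop ⌈sFive φ ψ s₀ s₁ + 3⌉₊)).exists
  refine ⟨M, le_trans (le_of_eq ?_) ((tsum_le_lintegral_growthIntegrand hm hn hg hgpos hφ hφpos
    ?_).trans hM1)⟩
  · subst hγ hf
    refine tsum_congr fun i => ?_
    have e1 : ((N₀ + (M + i) : ℕ) : ℝ) = (N₀ + M + s₀ : ℕ) + i - s₀ := by push_cast; ring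
    simp only [e1]
    push_cast
    simp only [add_assoc]
  · have h2 := Nat.le_ceil (sFive φ ψ s₀ s₁ + 3)
    have h3 : ((⌈sFive φ ψ s₀ s₁ + 3⌉₊ : ℕ) : ℝ) ≤ M := by exact_mod_cast hM2
    push_cast
    have h4 : (0 : ℝ) ≤ N₀ := N₀.cast_nonneg
    have h5 : (0 : ℝ) ≤ s₀ := s₀.cast_nonneg
    linarith

/-- The positive part of `u` is bounded on a product of balls whose concentric enlargement lies
in `Ω`. -/
theorem exists_bound_polydisc (m n : ℕ) (hn : 2 ≤ n) (hmn : n ≤ m) (K : ℝ) (hK : 1 ≤ K)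
    (Ω : Set (WithLp 2 (EuclideanSpace ℝ (Fin m) × EuclideanSpace ℝ (Fin n))))
    (u : WithLp 2 (EuclideanSpace ℝ (Fin m) × EuclideanSpace ℝ (Fin n)) → EReal)
    (hx : ∀ y : EuclideanSpace ℝ (Fin n),
      IsKQuasinearlySubharmonicOn K
        (fun x : EuclideanSpace ℝ (Fin m) => u (WithLp.toLp 2 (x, y)))
        {x | WithLp.toLp 2 (x, y) ∈ Ω})
    (hy : ∀ x : EuclideanSpace ℝ (Fin m),
      IsKQuasinearlySubharmonicOn K
        (fun y : EuclideanSpace ℝ (Fin n) => u (WithLp.toLp 2 (x, y)))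
        {y | WithLp.toLp 2 (x, y) ∈ Ω})
    (φ ψ : ℝ → ℝ) (hφ : IsIncreasingHalfLine φ) (hψ : IsIncreasingHalfLine ψ)
    (s₀ s₁ : ℕ) (hs : s₀ < s₁)
    (hc1φ : InverseDefinedOn φ (Ici (min (φ ((s₁ : ℝ) - s₀)) (ψ ((s₁ : ℝ) - s₀)))))
    (hc1ψ : InverseDefinedOn ψ (Ici (min (φ ((s₁ : ℝ) - s₀)) (ψ ((s₁ : ℝ) - s₀)))))
    (hc2 : ∀ s : ℝ, (s₁ : ℝ) ≤ s → 2 * K * invComp ψ φ (s - s₀) ≤ invComp ψ φ s)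
    (hc3 : IntegrableOn (growthIntegrand m n φ ψ s₀ s₁) (Ioi (sFive φ ψ s₀ s₁)) volume)
    (hc4 : LocallyIntegrableOn (fun z => ψ (realPosPart u z)) Ω volume)
    {a : EuclideanSpace ℝ (Fin m)} {b : EuclideanSpace ℝ (Fin n)} {ρ : ℝ} (hρ : 0 < ρ)
    (hab : ∀ x ∈ closedBall a (3 * ρ), ∀ y ∈ closedBall b (3 * ρ), WithLp.toLp 2 (x, y) ∈ Ω) :
    ∃ C : ENNReal, C ≠ ⊤ ∧ ∀ x ∈ ball a ρ, ∀ y ∈ ball b ρ,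
      truncShift u 0 (WithLp.toLp 2 (x, y)) ≤ C := by
  have hα : (0 : ℝ) ≤ (s₁ : ℝ) - s₀ := by
    have : (s₀ : ℝ) ≤ s₁ := by exact_mod_cast hs.le
    linarith
  have hα1 : ∀ s : ℝ, (s₁ : ℝ) + 1 ≤ s → (s₁ : ℝ) - s₀ < s := fun s h => by
    have : (0 : ℝ) ≤ s₀ := s₀.cast_nonneg
    linarith
  have hgpos : ∀ s : ℝ, (s₁ : ℝ) + 1 ≤ s → 0 < invComp ψ φ s := fun s h =>
    invComp_pos hφ hψ hα hc1φ hc1ψ (hα1 s h)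
  have hφpos : ∀ s : ℝ, (s₁ : ℝ) + 1 ≤ s → 0 < φ s := fun s h =>
    pos_of_inverseDefinedOn hφ hα hc1φ (hα1 s h)
  have hg : MonotoneOn (invComp ψ φ) (Ici ((s₁ : ℝ) + 1)) :=
    (strictMonoOn_invComp hφ hψ hα hc1φ hc1ψ).monotoneOn.mono
      (Ici_subset_Ici.2 (hα1 _ le_rfl).le)
  have hφm : MonotoneOn φ (Ici ((s₁ : ℝ) + 1)) :=
    (strictMonoOn_of_inverseDefinedOn hφ hα hc1φ).monotoneOn.mono
      (Ici_subset_Ici.2 (hα1 _ le_rfl).le)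
  have hlev : ∀ l : ℕ, (s₁ : ℝ) + 1 ≤ (s₁ + 1 + l : ℕ) := fun l => by
    push_cast; linarith [(l.cast_nonneg : (0 : ℝ) ≤ l)]
  have hsub3 : ∀ {x : EuclideanSpace ℝ (Fin m)}, x ∈ ball a (2 * ρ) → x ∈ closedBall a (3 * ρ) :=
    fun h => (ball_subset_closedBall.trans (closedBall_subset_closedBall (by linarith))) h
  have hsub3' : ∀ {y : EuclideanSpace ℝ (Fin n)}, y ∈ ball b (2 * ρ) → y ∈ closedBall b (3 * ρ) :=
    fun h => (ball_subset_closedBall.trans (closedBall_subset_closedBall (by linarith))) h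
  have hball_sub : ∀ y ∈ ball b (2 * ρ), ball a (2 * ρ) ⊆ {x | WithLp.toLp 2 (x, y) ∈ Ω} :=
    fun y hy x hx => hab x (hsub3 hx) y (hsub3' hy)
  have hball_sub' : ∀ x ∈ ball a (2 * ρ), ball b (2 * ρ) ⊆ {y | WithLp.toLp 2 (x, y) ∈ Ω} :=
    fun x hx y hy => hab x (hsub3 hx) y (hsub3' hy)
  -- The levels begin at `s₁ + 1`, where `φ` and `ψ⁻¹ ∘ φ` are already increasing and positive.
  refine exists_bound_of_separate_mean_value (finrank_euclideanSpace_fin (𝕜 := ℝ))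
    (finrank_euclideanSpace_fin (𝕜 := ℝ)) hn hmn (K := ENNReal.ofReal K)
    (γ := fun l => ENNReal.ofReal (invComp ψ φ (s₁ + 1 + l : ℕ)))
    (f := fun l => ENNReal.ofReal (φ (s₁ + 1 + l : ℕ))) (p := s₀)
    (v := fun x y => truncShift u 0 (WithLp.toLp 2 (x, y)))
    (Ψ := fun x y => ENNReal.ofReal (ψ (realPosPart u (WithLp.toLp 2 (x, y)))))
    (by simp; linarith) ENNReal.ofReal_ne_top ?_ ?_ (fun _ => ENNReal.ofReal_ne_top) ?_ ?_ ?_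
    (fun _ => ENNReal.ofReal_ne_top) ?_ hρ ?_ ?_ ?_ ?_ ?_ ?_ ?_ ?_
  · intro i j hij
    exact ENNReal.ofReal_le_ofReal (hg (hlev i) (hlev j) (by gcongr))
  · exact fun l => by simpa using hgpos _ (hlev l)
  · intro l
    have h1 := hc2 ((s₁ + 1 + (l + s₀) : ℕ) : ℝ)
      (by push_cast; linarith [(l.cast_nonneg : (0 : ℝ) ≤ l), (s₀.cast_nonneg : (0 : ℝ) ≤ s₀)])
    rw [show ((s₁ + 1 + (l + s₀) : ℕ) : ℝ) - s₀ = (s₁ + 1 + l : ℕ) by push_cast; ring] at h1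
    refine le_trans (le_of_eq ?_) (ENNReal.ofReal_le_ofReal h1)
    rw [ENNReal.ofReal_mul (by linarith), ENNReal.ofReal_mul (by norm_num), ENNReal.ofReal_ofNat]
  · refine ENNReal.tendsto_ofReal_atTop.comp
      ((tendsto_invComp_atTop hφ hψ hα hc1φ hc1ψ).comp ?_)
    exact tendsto_natCast_atTop_atTop.comp
      (tendsto_atTop_mono (fun l => Nat.le_add_left _ _) tendsto_id)
  · exact fun l => by simpa using hφpos _ (hlev l)
  · intro ε hε
    exact exists_small_tsum (hn.trans hmn) hn hg hgpos hφm hφpos hc3 rfl rfl hε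
  · intro y hyb
    exact (aemeasurable_truncShift (hx y).measurable 0).mono_measure
      (Measure.restrict_mono (hball_sub y hyb) le_rfl)
  · intro x hxa
    exact (aemeasurable_truncShift (hy x).measurable 0).mono_measure
      (Measure.restrict_mono (hball_sub' x hxa) le_rfl)
  · exact fun y hyb x r hr hsub =>
      (hx y).mean_value x r hr (hsub.trans (hball_sub y hyb)) 0 le_rfl
  · exact fun x hxa y r hr hsub =>
      (hy x).mean_value y r hr (hsub.trans (hball_sub' x hxa)) 0 le_rfl
  · exact fun y hyb => (hx y).exists_bound hρ fun x hxc => hab x hxc y (hsub3' hyb)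
  · exact fun x hxa => (hy x).exists_bound hρ fun y hyc => hab x (hsub3 hxa) y hyc
  · intro x hxa y hyb l hl
    have hlt : u (WithLp.toLp 2 (x, y)) < ⊤ := (hx y).lt_top x (hball_sub y hyb hxa)
    rw [truncShift_zero_eq_ofReal hlt] at hl
    have h0 : 0 ≤ realPosPart u (WithLp.toLp 2 (x, y)) := EReal.toReal_nonneg (le_max_right _ _)
    have hspec := invComp_spec hφ hα hc1ψ (hα1 _ (hlev l)).le
    rw [← hspec.2]
    exact ENNReal.ofReal_le_ofReal (hψ.1 hspec.1 h0 ((ENNReal.ofReal_le_ofReal_iff h0).1 hl))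
  · set S : Set (WithLp 2 (EuclideanSpace ℝ (Fin m) × EuclideanSpace ℝ (Fin n))) :=
      WithLp.ofLp ⁻¹' ball a (2 * ρ) ×ˢ ball b (2 * ρ)
    have hint : IntegrableOn (fun z => ψ (realPosPart u z)) S := by
      have hcomp : IsCompact ((WithLp.toLp 2 : _ → WithLp 2 (EuclideanSpace ℝ (Fin m) ×
          EuclideanSpace ℝ (Fin n))) '' (closedBall a (3 * ρ) ×ˢ closedBall b (3 * ρ))) :=
        ((isCompact_closedBall _ _).prod (isCompact_closedBall _ _)).image
          (WithLp.prod_continuous_toLp 2 _ _)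
      refine (hc4.integrableOn_compact_subset ?_ hcomp).mono_set ?_
      · rintro _ ⟨⟨x, y⟩, ⟨h1, h2⟩, rfl⟩
        exact hab x h1 y h2
      · exact fun z hz => ⟨z.ofLp, ⟨hsub3 hz.1, hsub3' hz.2⟩, rfl⟩
    rw [← (setLIntegral_withLp_prod (f := fun z => ENNReal.ofReal (ψ (realPosPart u z)))
      hint.aestronglyMeasurable.aemeasurable.ennreal_ofReal).2]
    exact ne_top_of_le_ne_top hint.2.ne (lintegral_mono fun z => Real.ofReal_le_enorm _)

theorem theorem4p1 (m n : ℕ) (hn : 2 ≤ n) (hmn : n ≤ m) (K : ℝ) (hK : 1 ≤ K)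
    (Ω : Set (WithLp 2 (EuclideanSpace ℝ (Fin m) × EuclideanSpace ℝ (Fin n))))
    (hΩ_open : IsOpen Ω) (hΩ_conn : IsConnected Ω)
    (u : WithLp 2 (EuclideanSpace ℝ (Fin m) × EuclideanSpace ℝ (Fin n)) → EReal)
    (hu_top : ∀ z ∈ Ω, u z < ⊤)
    (hu_meas : NullMeasurable u (volume.restrict Ω))
    (hx : ∀ y : EuclideanSpace ℝ (Fin n),
      IsKQuasinearlySubharmonicOn K
        (fun x : EuclideanSpace ℝ (Fin m) => u (WithLp.toLp 2 (x, y)))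
        {x | WithLp.toLp 2 (x, y) ∈ Ω})
    (hy : ∀ x : EuclideanSpace ℝ (Fin m),
      IsKQuasinearlySubharmonicOn K
        (fun y : EuclideanSpace ℝ (Fin n) => u (WithLp.toLp 2 (x, y)))
        {y | WithLp.toLp 2 (x, y) ∈ Ω})
    (φ ψ : ℝ → ℝ) (hφ : IsIncreasingHalfLine φ) (hψ : IsIncreasingHalfLine ψ)
    (s₀ s₁ : ℕ) (hs : s₀ < s₁)
    (hc1φ : InverseDefinedOn φ (Ici (min (φ ((s₁ : ℝ) - s₀)) (ψ ((s₁ : ℝ) - s₀)))))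
    (hc1ψ : InverseDefinedOn ψ (Ici (min (φ ((s₁ : ℝ) - s₀)) (ψ ((s₁ : ℝ) - s₀)))))
    (hc2 : ∀ s : ℝ, (s₁ : ℝ) ≤ s → 2 * K * invComp ψ φ (s - s₀) ≤ invComp ψ φ s)
    (hc3 : IntegrableOn (growthIntegrand m n φ ψ s₀ s₁) (Ioi (sFive φ ψ s₀ s₁)) volume)
    (hc4 : LocallyIntegrableOn (fun z => ψ (realPosPart u z)) Ω volume) :
    IsQuasinearlySubharmonicOn u Ω := by
  refine ⟨K ^ 2 * 2 ^ Module.finrank ℝ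
    (WithLp 2 (EuclideanSpace ℝ (Fin m) × EuclideanSpace ℝ (Fin n))), ?_, hu_top, hu_meas, ?_,
    fun z r hr hsub M hM => truncShift_le_of_separate hu_meas hx hy hr hsub hM⟩
  · exact one_le_mul_of_one_le_of_one_le (one_le_pow₀ hK) (one_le_pow₀ (by norm_num))
  · intro z hz
    obtain ⟨r, hr, hrΩ⟩ := nhds_basis_closedBall.mem_iff.1 (hΩ_open.mem_nhds hz)
    have hρ : 0 < r / 6 := by positivity
    obtain ⟨C, hC, hCb⟩ := exists_bound_polydisc m n hn hmn K hK Ω u hx hy φ ψ hφ hψ s₀ s₁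
      hs hc1φ hc1ψ hc2 hc3 hc4 (a := z.fst) (b := z.snd) hρ (fun x hxa y hyb => hrΩ
        (mem_closedBall.2 ((WithLp.dist_prod_le _ _).trans (by
          rw [mem_closedBall] at hxa hyb
          change dist x z.fst + dist y z.snd ≤ r
          linarith))))
    have hSnhds : WithLp.ofLp ⁻¹' ball z.fst (r / 6) ×ˢ ball z.snd (r / 6) ∈ 𝓝 z :=
      ((isOpen_ball.prod isOpen_ball).preimage (WithLp.prod_continuous_ofLp 2 _ _)).mem_nhds
        ⟨mem_ball_self hρ, mem_ball_self hρ⟩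
    refine ⟨(WithLp.ofLp ⁻¹' ball z.fst (r / 6) ×ˢ ball z.snd (r / 6)) ∩ ball z r,
      mem_nhdsWithin_of_mem_nhds (inter_mem hSnhds (ball_mem_nhds z hr)), ?_⟩
    have hsub : (WithLp.ofLp ⁻¹' ball z.fst (r / 6) ×ˢ ball z.snd (r / 6)) ∩ ball z r ⊆ Ω :=
      (inter_subset_right.trans ball_subset_closedBall).trans hrΩ
    have hmeas : MeasurableSet
        ((WithLp.ofLp ⁻¹' ball z.fst (r / 6) ×ˢ ball z.snd (r / 6)) ∩ ball z r) :=
      ((isOpen_ball.prod isOpen_ball).preimage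
        (WithLp.prod_continuous_ofLp 2 _ _)).measurableSet.inter measurableSet_ball
    have hfin : volume
        ((WithLp.ofLp ⁻¹' ball z.fst (r / 6) ×ˢ ball z.snd (r / 6)) ∩ ball z r) < ⊤ :=
      (measure_mono inter_subset_right).trans_lt measure_ball_lt_top
    have : Fact (volume
        ((WithLp.ofLp ⁻¹' ball z.fst (r / 6) ×ˢ ball z.snd (r / 6)) ∩ ball z r) < ⊤) := ⟨hfin⟩
    refine Integrable.of_bound (C := C.toReal) ?_ ?_
    · exact ((aemeasurable_realPosPart hu_meas).mono_measure
        (Measure.restrict_mono hsub le_rfl)).aestronglyMeasurable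
    · filter_upwards [ae_restrict_mem hmeas] with w hw
      have h1 := hCb _ hw.1.1 _ hw.1.2
      have h2 : 0 ≤ realPosPart u w := EReal.toReal_nonneg (le_max_right _ _)
      rw [Real.norm_of_nonneg h2]
      rw [truncShift_zero_eq_ofReal (hu_top _ (hsub hw))] at h1
      exact (ENNReal.ofReal_le_iff_le_toReal hC).1 h1
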